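/- Let $M$ be a complete smooth $n$-dimensional Riemannian manifold with distance function $d$, and let $\exp_x : T_xM \to M$ be its exponential map. Let $D_x\subset T_xM$ be the injectivity domain of $\exp_x$, that is, the set of $v\in T_xM$ lying strictly before the cut point in their direction: $d(x,\exp_x(sv)) = s\|v\|$ for some $s>1$. The map $\exp_x$ is injective on $D_x$, and $\exp_x^{-1}$ denotes the inverse of $\exp_x|_{D_x}$; it is defined on $\exp_x(D_x)$, the complement of the cut locus of $x$. A set $S\subset M$ is called strongly convex if any two points of $S$ are connected by a unique minimizing geodesic of $M$ and this geodesic segment lies entirely in $S$. **Proposition.** Let $S\subset M$ be strongly convex and let $x\in S$ be such that $\exp_x^{-1}$ is defined at every point of $S$ (i.e. $S\subset \exp_x(D_x)$). Assume that for all weights $0\le w_1,w_2\le 1$ with $w_1+w_2=1$, all $y_1,y_2\in S$ and all $t\in[0,1]$, $$\exp_x\bigl(t\,(w_1\exp_x^{-1}y_1+w_2\exp_x^{-1}y_2)\bigr)\in S .$$ Then for every $N$, all points $x_1,\dots,x_N\in S$ and all weights $0\le w_i\le 1$ with $\sum_{i=1}^N w_i=1$, $$\exp_x\Bigl(t\sum_{i=1}^N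 w_i\exp_x^{-1}x_i\Bigr)\in S\qquad\text{for all } t\in[0,1].$$ -/

import Mathlib

open Set Manifold Bundle
open scoped ContDiff

noncomputable section

namespace RiemGeo

variable (n : ℕ) {M : Type*} [MetricSpace M] [ChartedSpace (EuclideanSpace ℝ (Fin n)) M]
  [RiemannianBundle (fun x : M => TangentSpace (𝓡 n) x)]

/-- The Riemannian metric read in the preferred chart `φ` around `p`: the number
`g (dφ⁻¹ a, dφ⁻¹ b)` at the point with coordinates `z`. In terms of the standard basis,
`chartMetric n p z eᵢ eⱼ` is the coefficient `gᵢⱼ(z)`. It is meaningful for `z` in the (open)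
target of the chart. -/
def chartMetric (p : M) (z a b : EuclideanSpace ℝ (Fin n)) : ℝ :=
  inner ℝ
    (mfderiv (𝓡 n) (𝓡 n) (extChartAt (𝓡 n) p).symm z a :
      TangentSpace (𝓡 n) ((extChartAt (𝓡 n) p).symm z))
    (mfderiv (𝓡 n) (𝓡 n) (extChartAt (𝓡 n) p).symm z b)

/-- Christoffel symbols of the first kind of the Levi-Civita connection in the preferred chart
around `p`: `christoffel n p z eᵢ eⱼ eₖ = ½ (∂ᵢ gⱼₖ + ∂ⱼ gᵢₖ - ∂ₖ gᵢⱼ)(z)`. -/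
def christoffel (p : M) (z u v a : EuclideanSpace ℝ (Fin n)) : ℝ :=
  (1 / 2 : ℝ) *
    (fderiv ℝ (fun z' => chartMetric n p z' v a) z u
      + fderiv ℝ (fun z' => chartMetric n p z' u a) z v
      - fderiv ℝ (fun z' => chartMetric n p z' u v) z a)

/-- A (complete, affinely parametrized) geodesic `γ : ℝ → M`: a `C²` curve which satisfies the
geodesic equation `∇_{γ'} γ' = 0` of the Levi-Civita connection. In each chart, with `c` the
coordinate expression of `γ`, the equation reads `c'' + Γ(c)(c', c') = 0`; it is written here with
the index lowered, that is, paired by the metric with an arbitrary vector `a`. -/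
def IsGeodesic (γ : ℝ → M) : Prop :=
  ContMDiff 𝓘(ℝ, ℝ) (𝓡 n) 2 γ ∧
    ∀ (p : M) (t : ℝ), γ t ∈ (extChartAt (𝓡 n) p).source →
      ∀ a : EuclideanSpace ℝ (Fin n),
        chartMetric n p (extChartAt (𝓡 n) p (γ t))
            (deriv (deriv (fun s => extChartAt (𝓡 n) p (γ s))) t) a
          + christoffel n p (extChartAt (𝓡 n) p (γ t))
            (deriv (fun s => extChartAt (𝓡 n) p (γ s)) t)
            (deriv (fun s => extChartAt (𝓡 n) p (γ s)) t) a = 0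

/-- `γ` restricted to `[0, 1]` is a minimizing geodesic from `x` to `y`: its length equals the
distance. (On a complete manifold each geodesic segment `[0, 1] → M` is the restriction of a
geodesic that is defined on all of `ℝ`.) -/
def IsMinimizingGeodesic (γ : ℝ → M) (x y : M) : Prop :=
  IsGeodesic n γ ∧ γ 0 = x ∧ γ 1 = y ∧ pathELength (𝓡 n) γ 0 1 = edist x y

/-- `A` is strongly convex: any two points of `A` are connected by a unique minimizing geodesic of
`M`, and this geodesic segment lies entirely in `A`. -/
def StronglyConvex (A : Set M) : Prop :=
  ∀ x ∈ A, ∀ y ∈ A, ∃ γ : ℝ → M, IsMinimizingGeodesic n γ x y ∧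
    (∀ σ : ℝ → M, IsMinimizingGeodesic n σ x y → EqOn σ γ (Icc 0 1)) ∧
    ∀ t ∈ Icc (0 : ℝ) 1, γ t ∈ A

/-- `γ` is a geodesic with `γ 0 = x` and `γ' 0 = v`. -/
def IsGeodesicFrom (x : M) (v : TangentSpace (𝓡 n) x) (γ : ℝ → M) : Prop :=
  IsGeodesic n γ ∧
    (⟨γ 0, mfderiv 𝓘(ℝ, ℝ) (𝓡 n) γ 0 (1 : ℝ)⟩ : TangentBundle (𝓡 n) M) = ⟨x, v⟩

open Classical in
/-- The exponential map: `exp_x v = γ 1` for the geodesic `γ` with `γ 0 = x`, `γ' 0 = v`. On a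
complete manifold this geodesic exists for every `v`, and it is unique; the default value `x` is
never taken there. -/
def expMap (x : M) (v : TangentSpace (𝓡 n) x) : M :=
  if h : ∃ γ : ℝ → M, IsGeodesicFrom n x v γ then h.choose 1 else x

/-- The injectivity domain of `exp_x` in `T_x M`: the vectors `v` that lie strictly before the cut
point in their direction, which means that the geodesic `t ↦ exp_x (t v)` is still minimizing up to
some time `s > 1`. Its boundary is the tangential cut locus. -/
def injectivityDomain (x : M) : Set (TangentSpace (𝓡 n) x) :=
  {v | ∃ s : ℝ, 1 < s ∧ dist x (expMap n x (s • v)) = s * ‖v‖}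

open Classical in
/-- `exp_x⁻¹`, the inverse of the restriction of `exp_x` to its injectivity domain. It is defined at
the points of `expMap n x '' injectivityDomain n x` (the complement of the cut locus of `x`);
elsewhere it has the default value `0`. -/
def expInv (x y : M) : TangentSpace (𝓡 n) x :=
  if h : ∃ v ∈ injectivityDomain n x, expMap n x v = y then h.choose else 0

end RiemGeo

end

/-! Let V be the set of vectors of the injectivity domain of `exp_x` that `exp_x` sends into S.
Since S avoids the cut locus, V is exactly the set of logarithms of points of S. If V is convex,
then the weighted sum of logarithms lies in V, and the two-point hypothesis with both points equal
to its exponential covers the scaled vectors. So everything reduces to convexity of V.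

For a convex combination u of two vectors of V, the two-point hypothesis puts the whole radial
geodesic t ↦ exp_x(tu), t ∈ [0,1], in S. This alone is not enough: if u were past the tangential cut
locus, it would not be the logarithm of its endpoint, and the hypothesis could not be iterated.
`StronglyConvex.mem_injectivityDomain_of_ray` excludes this. Let τ be the last time in [0,1] up to
which the ray minimizes. Its point at time τ lies in S, so it has a logarithm v, and uniqueness of
minimizing geodesics forces v = τu. But v lies strictly before its cut point, so the ray still
minimizes after τ; by maximality it does so past time 1. The argument needs τ > 0, which comes from
injectivity of `exp_x` near the origin (`exists_pos_forall_eq_of_isGeodesicFrom`).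

The rest is the Riemannian geometry behind this: the geodesic equation as an autonomous first order
system in a chart, its independence of the chart, uniqueness and constant speed of geodesics, and
geodesic completeness (`exists_isGeodesic`). -/

noncomputable section

set_option maxSynthPendingDepth 3
set_option linter.unusedSectionVars false

namespace RiemGeo

open Filter Topology Metric

/-! ### Geodesic equation of a metric on a vector space, and ODE tools -/

section Calculus

variable {E : Type*} [NormedAddCommGroup E] [NormedSpace ℝ E]

/-- The covector `a ↦ Γ(w, w, a)` of the Christoffel symbols of the first kind of a metric `G` on an
open set of a vector space. -/
def sprayCovector (G : E → E →L[ℝ] E →L[ℝ] ℝ) (z w : E) : E →L[ℝ] ℝ :=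
  fderiv ℝ G z w w - (1 / 2 : ℝ) • ((fderiv ℝ G z).flip w).flip w

lemma sprayCovector_apply (G : E → E →L[ℝ] E →L[ℝ] ℝ) (z w a : E) :
    sprayCovector G z w a = fderiv ℝ G z w w a - (1 / 2 : ℝ) * fderiv ℝ G z a w w := by
  simp [sprayCovector]

/-- The geodesic spray `(z, w) ↦ Γ(w, w)` with the index raised. -/
def spray (G : E → E →L[ℝ] E →L[ℝ] ℝ) (q : E × E) : E :=
  (G q.1).inverse (sprayCovector G q.1 q.2)

/-- `ContinuousLinearMap.inverse` takes the default value `0` at non-invertible maps, so raising the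
index is meaningful only where the metric is nondegenerate. -/
lemma metric_spray {G : E → E →L[ℝ] E →L[ℝ] ℝ} {z : E} (hG : (G z).IsInvertible) (w : E) :
    G z (spray G (z, w)) = sprayCovector G z w := by
  obtain ⟨e, he⟩ := hG
  simp only [spray, ← he, ContinuousLinearMap.inverse_equiv]
  simp

/-- The first order vector field on `E × E` whose integral curves are the geodesics of `G`. -/
def geodesicField (G : E → E →L[ℝ] E →L[ℝ] ℝ) (q : E × E) : E × E := (q.2, -spray G q)

lemma contDiffAt_sprayCovector {G : E → E →L[ℝ] E →L[ℝ] ℝ} {q : E × E}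
    (hG : ContDiffAt ℝ 2 G q.1) :
    ContDiffAt ℝ 1 (fun q : E × E => sprayCovector G q.1 q.2) q := by
  have h1 : ContDiffAt ℝ 1 (fun q : E × E => fderiv ℝ G q.1) q :=
    (hG.fderiv_right (m := 1) (by norm_num)).comp q contDiffAt_fst
  have h2 : ContDiffAt ℝ 1 (fun q : E × E => q.2) q := contDiffAt_snd
  have h3 : ContDiffAt ℝ 1 (fun q : E × E => (fderiv ℝ G q.1).flip) q :=
    (ContinuousLinearMap.flipₗᵢ ℝ E E (E →L[ℝ] ℝ)).contDiff.contDiffAt.comp q h1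
  have h4 : ContDiffAt ℝ 1 (fun q : E × E => ((fderiv ℝ G q.1).flip q.2).flip) q :=
    (ContinuousLinearMap.flipₗᵢ ℝ E E ℝ).contDiff.contDiffAt.comp q (h3.clm_apply h2)
  exact ((h1.clm_apply h2).clm_apply h2).sub
    ((contDiffAt_const (c := (1 / 2 : ℝ))).smul (h4.clm_apply h2))

lemma contDiffAt_spray [CompleteSpace E] {G : E → E →L[ℝ] E →L[ℝ] ℝ} {q : E × E}
    (hG : ContDiffAt ℝ 2 G q.1) (hi : (G q.1).IsInvertible) : ContDiffAt ℝ 1 (spray G) q := by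
  have h1 : ContDiffAt ℝ 1 (fun q : E × E => (G q.1).inverse) q :=
    (hi.contDiffAt_map_inverse).comp q ((hG.of_le (by norm_num)).comp q contDiffAt_fst)
  exact h1.clm_apply (contDiffAt_sprayCovector hG)

lemma contDiffAt_geodesicField [CompleteSpace E] {G : E → E →L[ℝ] E →L[ℝ] ℝ} {q : E × E}
    (hG : ContDiffAt ℝ 2 G q.1) (hi : (G q.1).IsInvertible) :
    ContDiffAt ℝ 1 (geodesicField G) q :=
  contDiffAt_snd.prodMk (contDiffAt_spray hG hi).neg

/-- The spray is quadratic in the velocity: along s ↦ (z + sv, sw) it equals s² times a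
differentiable function, so its derivative vanishes at zero velocity. Near such a point its
Lipschitz constant is therefore as small as desired, which gives local injectivity of the
exponential map. -/
lemma hasStrictFDerivAt_spray [CompleteSpace E] {G : E → E →L[ℝ] E →L[ℝ] ℝ} {z : E}
    (hG : ContDiffAt ℝ 2 G z) (hi : (G z).IsInvertible) :
    HasStrictFDerivAt (spray G) (0 : E × E →L[ℝ] E) (z, 0) := by
  have h := (contDiffAt_spray (q := (z, 0)) hG hi).hasStrictFDerivAt one_ne_zero
  have hs : ∀ (s : ℝ) (y w : E), spray G (y, s • w) = s ^ 2 • spray G (y, w) := by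
    intro s y w
    simp only [spray]
    rw [← map_smul]
    congr 1
    ext a
    simp only [sprayCovector_apply, map_smul, _root_.smul_apply, smul_eq_mul]
    ring
  suffices H : ∀ p : E × E, fderiv ℝ (spray G) (z, 0) p = 0 by
    have : fderiv ℝ (spray G) (z, 0) = 0 := ContinuousLinearMap.ext H
    rwa [this] at h
  rintro ⟨v, w⟩
  have hl : HasDerivAt (fun s : ℝ => z + s • v) v 0 := by
    simpa using ((hasDerivAt_id (0 : ℝ)).smul_const v).const_add z
  have hw : HasDerivAt (fun s : ℝ => s • w) w 0 := by
    simpa using (hasDerivAt_id (0 : ℝ)).smul_const w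
  have h1 : HasDerivAt (fun s : ℝ => spray G (z + s • v, s • w))
      (fderiv ℝ (spray G) (z, 0) (v, w)) 0 := by
    have h0 : HasFDerivAt (spray G) (fderiv ℝ (spray G) (z, 0)) (z + (0 : ℝ) • v, (0 : ℝ) • w) := by
      simpa using h.hasFDerivAt
    exact h0.comp_hasDerivAt (0 : ℝ) (hl.prodMk hw)
  have h2 : DifferentiableAt ℝ (fun s : ℝ => spray G (z + s • v, w)) 0 := by
    have h0 : DifferentiableAt ℝ (spray G) (z + (0 : ℝ) • v, w) := by
      simpa using (contDiffAt_spray (q := (z, w)) hG hi).differentiableAt one_ne_zero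
    exact h0.comp (0 : ℝ) (hl.differentiableAt.prodMk (differentiableAt_const w))
  have h3 : HasDerivAt (fun s : ℝ => s ^ 2 • spray G (z + s • v, w)) 0 0 := by
    have h0 : HasDerivAt (fun s : ℝ => s ^ 2) 0 0 := by simpa using hasDerivAt_pow 2 (0 : ℝ)
    simpa using HasDerivAt.fun_smul h0 h2.hasDerivAt
  simp only [hs] at h1
  exact h1.unique h3

/-- Under a change of coordinates `ψ`, the Christoffel symbols of the first kind pick up the second
derivative of `ψ`. -/
lemma sprayCovector_of_pullback {G₁ G₂ : E → E →L[ℝ] E →L[ℝ] ℝ} {ψ : E → E} {z : E}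
    (hψ : ContDiffAt ℝ 2 ψ z) (h₁ : DifferentiableAt ℝ G₁ z) (h₂ : DifferentiableAt ℝ G₂ (ψ z))
    (hsymm : ∀ a b, G₂ (ψ z) a b = G₂ (ψ z) b a)
    (hpull : ∀ᶠ z' in 𝓝 z, ∀ a b, G₁ z' a b = G₂ (ψ z') (fderiv ℝ ψ z' a) (fderiv ℝ ψ z' b))
    (w a : E) :
    sprayCovector G₁ z w a = G₂ (ψ z) (fderiv ℝ (fderiv ℝ ψ) z w w) (fderiv ℝ ψ z a)
      + sprayCovector G₂ (ψ z) (fderiv ℝ ψ z w) (fderiv ℝ ψ z a) := by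
  have hψ1 : HasFDerivAt ψ (fderiv ℝ ψ z) z := (hψ.differentiableAt two_ne_zero).hasFDerivAt
  have hψ2 : HasFDerivAt (fderiv ℝ ψ) (fderiv ℝ (fderiv ℝ ψ) z) z :=
    ((hψ.fderiv_right (m := 1) (by norm_num)).differentiableAt one_ne_zero).hasFDerivAt
  -- Product rule for the pullback identity. In the Christoffel combination with b = w, all Hessian
  -- terms cancel except the one in (w, w), by symmetry of G₂ and of the second derivative of ψ.
  have key : ∀ u b c, fderiv ℝ G₁ z u b c =
      fderiv ℝ G₂ (ψ z) (fderiv ℝ ψ z u) (fderiv ℝ ψ z b) (fderiv ℝ ψ z c)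
      + G₂ (ψ z) (fderiv ℝ (fderiv ℝ ψ) z u b) (fderiv ℝ ψ z c)
      + G₂ (ψ z) (fderiv ℝ ψ z b) (fderiv ℝ (fderiv ℝ ψ) z u c) := by
    intro u b c
    have e1 := (h₁.hasFDerivAt.clm_apply (hasFDerivAt_const b z)).clm_apply (hasFDerivAt_const c z)
    have e2 := ((h₂.hasFDerivAt.comp z hψ1).clm_apply
      (hψ2.clm_apply (hasFDerivAt_const b z))).clm_apply (hψ2.clm_apply (hasFDerivAt_const c z))
    have e3 := e2.congr_of_eventuallyEq (hpull.mono fun z' h => h b c)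
    have := DFunLike.congr_fun (e1.unique e3) u
    simp at this
    rw [this]
    ring
  have hs : ∀ u v, fderiv ℝ (fderiv ℝ ψ) z u v = fderiv ℝ (fderiv ℝ ψ) z v u :=
    fun u v => (hψ.isSymmSndFDerivAt (by simp)).eq u v
  rw [sprayCovector_apply, sprayCovector_apply, key, key, hs a w,
    hsymm (fderiv ℝ (fderiv ℝ ψ) z w a)]
  ring

/-- Two solutions of a second order equation with the same values at times `0` and `1` coincide, as
long as they stay in a region where the right hand side has small Lipschitz constant. -/
lemma eq_of_second_order_of_lipschitz {X : E × E → E} {U : Set (E × E)}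
    (hX : ∀ p ∈ U, ∀ q ∈ U, ‖X p - X q‖ ≤ 1 / 2 * ‖p - q‖) {c₁ c₂ d₁ d₂ : ℝ → E}
    (hc₁ : ∀ t ∈ Icc (0 : ℝ) 1, HasDerivAt c₁ (d₁ t) t)
    (hc₂ : ∀ t ∈ Icc (0 : ℝ) 1, HasDerivAt c₂ (d₂ t) t)
    (hd₁ : ∀ t ∈ Icc (0 : ℝ) 1, HasDerivAt d₁ (-X (c₁ t, d₁ t)) t)
    (hd₂ : ∀ t ∈ Icc (0 : ℝ) 1, HasDerivAt d₂ (-X (c₂ t, d₂ t)) t)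
    (hU₁ : ∀ t ∈ Icc (0 : ℝ) 1, (c₁ t, d₁ t) ∈ U) (hU₂ : ∀ t ∈ Icc (0 : ℝ) 1, (c₂ t, d₂ t) ∈ U)
    (h0 : c₁ 0 = c₂ 0) (h1 : c₁ 1 = c₂ 1) : d₁ 0 = d₂ 0 := by
  have hh : ∀ t ∈ Icc (0 : ℝ) 1, HasDerivAt (fun t => c₁ t - c₂ t) (d₁ t - d₂ t) t :=
    fun t ht => (hc₁ t ht).sub (hc₂ t ht)
  have hf : ∀ t ∈ Icc (0 : ℝ) 1, HasDerivAt (fun t => d₁ t - d₂ t)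
      (-X (c₁ t, d₁ t) - -X (c₂ t, d₂ t)) t :=
    fun t ht => (hd₁ t ht).sub (hd₂ t ht)
  have hcont : ContinuousOn (fun t => ‖((c₁ t - c₂ t, d₁ t - d₂ t) : E × E)‖) (Icc 0 1) :=
    fun t ht => (((hh t ht).continuousAt.prodMk (hf t ht).continuousAt).norm).continuousWithinAt
  -- Let m be the maximal sup-norm distance between the two solutions in phase space. The aim is m ≤
  -- m/2.
  obtain ⟨τ, hτ, hmax⟩ := isCompact_Icc.exists_isMaxOn (nonempty_Icc.2 zero_le_one) hcont
  set m := ‖((c₁ τ - c₂ τ, d₁ τ - d₂ τ) : E × E)‖ with hm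
  have hm0 : 0 ≤ m := norm_nonneg _
  have hle : ∀ t ∈ Icc (0 : ℝ) 1, ‖((c₁ t - c₂ t, d₁ t - d₂ t) : E × E)‖ ≤ m := fun t ht => hmax ht
  have hconv : Convex ℝ (Icc (0 : ℝ) 1) := convex_Icc 0 1
  have hf' : ∀ t ∈ Icc (0 : ℝ) 1, ‖-X (c₁ t, d₁ t) - -X (c₂ t, d₂ t)‖ ≤ 1 / 2 * m := by
    intro t ht
    rw [neg_sub_neg, norm_sub_rev]
    exact (hX _ (hU₁ t ht) _ (hU₂ t ht)).trans
      (mul_le_mul_of_nonneg_left (hle t ht) (by norm_num))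
  have hfs : ∀ s ∈ Icc (0 : ℝ) 1, ∀ t ∈ Icc (0 : ℝ) 1,
      ‖(d₁ s - d₂ s) - (d₁ t - d₂ t)‖ ≤ 1 / 2 * m := by
    intro s hs t ht
    refine (hconv.norm_image_sub_le_of_norm_hasDerivWithin_le
      (fun r hr => (hf r hr).hasDerivWithinAt) hf' ht hs).trans ?_
    have : ‖s - t‖ ≤ 1 := by
      rw [Real.norm_eq_abs, abs_le]
      constructor <;> linarith [hs.1, hs.2, ht.1, ht.2]
    nlinarith
  -- The velocity difference has mean zero, because the position difference vanishes at both ends,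
  -- and it oscillates by at most m/2; hence it is bounded by m/2. The mean is taken through the
  -- mean value inequality for (c₁ - c₂)(s) - s(d₁ - d₂)(t).
  have hfb : ∀ t ∈ Icc (0 : ℝ) 1, ‖d₁ t - d₂ t‖ ≤ 1 / 2 * m := by
    intro t ht
    have := hconv.norm_image_sub_le_of_norm_hasDerivWithin_le
      (f := fun s => (c₁ s - c₂ s) - s • (d₁ t - d₂ t))
      (f' := fun s => (d₁ s - d₂ s) - (d₁ t - d₂ t)) (C := 1 / 2 * m)
      (fun s hs => by
        have := ((hasDerivAt_id s).smul_const (d₁ t - d₂ t))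
        rw [one_smul] at this
        exact ((hh s hs).sub this).hasDerivWithinAt)
      (fun s hs => hfs s hs t ht) (left_mem_Icc.2 zero_le_one) (right_mem_Icc.2 zero_le_one)
    simpa [h0, h1, norm_sub_rev] using this
  have hhb : ‖c₁ τ - c₂ τ‖ ≤ 1 / 2 * m := by
    have := hconv.norm_image_sub_le_of_norm_hasDerivWithin_le
      (fun s hs => (hh s hs).hasDerivWithinAt) hfb (left_mem_Icc.2 zero_le_one) hτ
    simp only [h0, sub_self, sub_zero] at this
    refine this.trans ?_
    have : ‖τ‖ ≤ 1 := by
      rw [Real.norm_eq_abs, abs_of_nonneg hτ.1]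
      exact hτ.2
    nlinarith
  have hmm : m ≤ 1 / 2 * m := by
    conv_lhs => rw [hm, Prod.norm_def]
    exact max_le hhb (hfb τ hτ)
  have hz : ‖d₁ 0 - d₂ 0‖ ≤ 0 := by
    have := hfb 0 (left_mem_Icc.2 zero_le_one)
    linarith
  exact sub_eq_zero.1 (norm_le_zero_iff.1 hz)

/-- A `C¹` vector field has a local flow with a uniform existence time whose orbits stay in a
prescribed neighbourhood. -/
lemma exists_local_flow_mem {F : Type*} [NormedAddCommGroup F] [NormedSpace ℝ F] [CompleteSpace F]
    {f : F → F} {x₀ : F} (hf : ContDiffAt ℝ 1 f x₀) {U : Set F} (hU : U ∈ 𝓝 x₀) :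
    ∃ r > (0 : ℝ), ∃ ε > (0 : ℝ), ∀ x ∈ closedBall x₀ r, ∃ α : ℝ → F, α 0 = x ∧
      ∀ t ∈ Ioo (-ε) ε, HasDerivAt α (f (α t)) t ∧ α t ∈ U := by
  obtain ⟨ε, hε, a, r, _, _, hr, hpl⟩ := IsPicardLindelof.of_contDiffAt_one hf
  obtain ⟨α, hα, hcont⟩ :=
    (hpl 0).exists_forall_mem_closedBall_eq_hasDerivWithinAt_continuousOn
  have hr' : (0 : ℝ) < r := hr
  have hmem : closedBall x₀ r ×ˢ Icc (0 - ε) (0 + ε) ∈ 𝓝 (x₀, (0 : ℝ)) :=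
    prod_mem_nhds (closedBall_mem_nhds _ hr') (Icc_mem_nhds (by linarith) (by linarith))
  -- Joint continuity in initial point and time gives one radius δ that keeps all nearby orbits in U
  -- for short times.
  have hc : ContinuousAt α (x₀, 0) := hcont.continuousAt hmem
  have h0 : α (x₀, 0) = x₀ := (hα x₀ (mem_closedBall_self hr'.le)).1
  have hU' : α ⁻¹' U ∈ 𝓝 (x₀, (0 : ℝ)) := hc (by rwa [h0])
  obtain ⟨δ, hδ, hsub⟩ := Metric.nhds_basis_closedBall.mem_iff.1 (inter_mem hU' hmem)
  refine ⟨δ, hδ, δ, hδ, fun x hx => ⟨fun t => α (x, t), ?_, fun t ht => ?_⟩⟩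
  · have : (x, (0 : ℝ)) ∈ closedBall (x₀, (0 : ℝ)) δ := by
      rw [← closedBall_prod_same]
      exact ⟨hx, mem_closedBall_self hδ.le⟩
    exact (hα x (hsub this).2.1).1
  · have hxt : ∀ s ∈ Ioo (-δ) δ, (x, s) ∈ closedBall (x₀, (0 : ℝ)) δ := by
      intro s hs
      rw [← closedBall_prod_same]
      refine ⟨hx, ?_⟩
      rw [mem_closedBall, Real.dist_eq, sub_zero]
      exact abs_le.2 ⟨hs.1.le, hs.2.le⟩
    refine ⟨?_, (hsub (hxt t ht)).1⟩
    refine ((hα x (hsub (hxt t ht)).2.1).2 t (hsub (hxt t ht)).2.2).hasDerivAt ?_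
    exact Filter.mem_of_superset (Ioo_mem_nhds ht.1 ht.2) fun s hs => (hsub (hxt s hs)).2.2

/-- Local uniqueness for an autonomous `C¹` vector field. -/
lemma eventuallyEq_of_hasDerivAt {F : Type*} [NormedAddCommGroup F] [NormedSpace ℝ F]
    {f : F → F} {α β : ℝ → F} {t₀ : ℝ} (hf : ContDiffAt ℝ 1 f (α t₀))
    (hα : ∀ᶠ t in 𝓝 t₀, HasDerivAt α (f (α t)) t) (hβ : ∀ᶠ t in 𝓝 t₀, HasDerivAt β (f (β t)) t)
    (h : α t₀ = β t₀) : α =ᶠ[𝓝 t₀] β := by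
  obtain ⟨K, s, hs, hl⟩ := hf.exists_lipschitzOnWith
  have hα' := hα.self_of_nhds.continuousAt hs
  have hβ' := hβ.self_of_nhds.continuousAt (h ▸ hs)
  exact ODE_solution_unique_of_eventually (v := fun _ => f) (s := fun _ => s)
    (Eventually.of_forall fun _ => hl) (hα.and hα') (hβ.and hβ') h

end Calculus

/-! ### The metric, tangent vectors and velocities in charts -/

section Chart

variable {n : ℕ} {M : Type*} [MetricSpace M] [ChartedSpace (EuclideanSpace ℝ (Fin n)) M]
  [RiemannianBundle (fun x : M => TangentSpace (𝓡 n) x)]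

lemma chartMetric_comm (p : M) (z a b : EuclideanSpace ℝ (Fin n)) :
    chartMetric n p z a b = chartMetric n p z b a :=
  real_inner_comm _ _

lemma chartMetric_add_left (p : M) (z a a' b : EuclideanSpace ℝ (Fin n)) :
    chartMetric n p z (a + a') b = chartMetric n p z a b + chartMetric n p z a' b := by
  have h := (mfderiv (𝓡 n) (𝓡 n) (extChartAt (𝓡 n) p).symm z).map_add a a'
  exact (congrArg (fun v => inner ℝ v _) h).trans (inner_add_left _ _ _)

lemma chartMetric_smul_left (p : M) (c : ℝ) (z a b : EuclideanSpace ℝ (Fin n)) :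
    chartMetric n p z (c • a) b = c * chartMetric n p z a b := by
  have h := (mfderiv (𝓡 n) (𝓡 n) (extChartAt (𝓡 n) p).symm z).map_smul c a
  exact (congrArg (fun v => inner ℝ v _) h).trans (real_inner_smul_left _ _ _)

/-- The metric read in the chart around `p`, as a map to continuous bilinear forms. -/
def metricInChart (p : M) (z : EuclideanSpace ℝ (Fin n)) :
    EuclideanSpace ℝ (Fin n) →L[ℝ] EuclideanSpace ℝ (Fin n) →L[ℝ] ℝ :=
  LinearMap.toContinuousLinearMap
    ((LinearMap.toContinuousLinearMap (E := EuclideanSpace ℝ (Fin n)) (F' := ℝ)).toLinearMap ∘ₗ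
      LinearMap.mk₂ ℝ (chartMetric n p z) (chartMetric_add_left p z)
        (fun c => chartMetric_smul_left p c z)
        (fun a b b' => by
          rw [chartMetric_comm, chartMetric_add_left, chartMetric_comm, chartMetric_comm p z b'])
        (fun c a b => by
          rw [chartMetric_comm, chartMetric_smul_left, chartMetric_comm, smul_eq_mul]))

lemma chartMetric_add_self (p : M) (z a b : EuclideanSpace ℝ (Fin n)) :
    chartMetric n p z (a + b) (a + b)
      = chartMetric n p z a a + 2 * chartMetric n p z a b + chartMetric n p z b b := by
  rw [chartMetric_add_left, chartMetric_comm p z a (a + b), chartMetric_comm p z b (a + b),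
    chartMetric_add_left, chartMetric_add_left, chartMetric_comm p z b a]
  ring

lemma metricInChart_apply (p : M) (z a b : EuclideanSpace ℝ (Fin n)) :
    metricInChart p z a b = chartMetric n p z a b := rfl

variable [IsManifold (𝓡 n) ∞ M]

/-- Smoothness of the constant-coefficient coordinate fields; paired by the bundle metric, they give
smooth metric coefficients. -/
lemma contMDiffOn_mfderiv_symm (p : M) (a : EuclideanSpace ℝ (Fin n)) :
    ContMDiffOn 𝓘(ℝ, EuclideanSpace ℝ (Fin n)) (𝓡 n).tangent ∞
      (fun z => (⟨(extChartAt (𝓡 n) p).symm z,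
        mfderiv (𝓡 n) (𝓡 n) (extChartAt (𝓡 n) p).symm z a⟩ : TangentBundle (𝓡 n) M))
      (extChartAt (𝓡 n) p).target := by
  have ho : IsOpen (extChartAt (𝓡 n) p).target := isOpen_extChartAt_target p
  have h1 := (contMDiffOn_extChartAt_symm (I := 𝓡 n) (n := ∞) p).contMDiffOn_tangentMapWithin
    (m := ∞) (by simp) ho.uniqueMDiffOn
  have h2 : ContMDiff 𝓘(ℝ, EuclideanSpace ℝ (Fin n)) (𝓘(ℝ, EuclideanSpace ℝ (Fin n)).tangent) ∞
      (fun z => (⟨z, a⟩ : TangentBundle 𝓘(ℝ, EuclideanSpace ℝ (Fin n))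
        (EuclideanSpace ℝ (Fin n)))) :=
    contMDiff_vectorSpace_iff_contDiff.2 contDiff_const
  refine (h1.comp h2.contMDiffOn (fun z hz => hz)).congr fun z hz => ?_
  simp only [Function.comp_apply, tangentMapWithin]
  rw [mfderivWithin_of_mem_nhds (ho.mem_nhds hz)]

/-- The equality is stated in the total space because the two vectors have different, only
propositionally equal, base points. All tangent spaces unfold to the model space, so the fibre part
is still an ordinary equality. -/
lemma mfderiv_extChartAt_symm_comp {p y : M} (hy : y ∈ (extChartAt (𝓡 n) p).source)
    (v : TangentSpace (𝓡 n) y) :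
    (⟨(extChartAt (𝓡 n) p).symm (extChartAt (𝓡 n) p y),
        mfderiv (𝓡 n) (𝓡 n) (extChartAt (𝓡 n) p).symm (extChartAt (𝓡 n) p y)
          (mfderiv (𝓡 n) 𝓘(ℝ, EuclideanSpace ℝ (Fin n)) (extChartAt (𝓡 n) p) y v)⟩ :
        TangentBundle (𝓡 n) M) = ⟨y, v⟩ := by
  have h := mfderivWithin_extChartAt_symm_comp_mfderiv_extChartAt' (I := 𝓡 n) hy
  rw [ModelWithCorners.Boundaryless.range_eq_univ, mfderivWithin_univ] at h
  exact TotalSpace.ext ((extChartAt (𝓡 n) p).left_inv hy) (heq_of_eq (DFunLike.congr_fun h v))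

variable [IsContMDiffRiemannianBundle (𝓡 n) ∞ (EuclideanSpace ℝ (Fin n))
      (fun x : M => TangentSpace (𝓡 n) x)]

lemma contDiffOn_metricInChart (p : M) :
    ContDiffOn ℝ ∞ (metricInChart (n := n) p) (extChartAt (𝓡 n) p).target := by
  rw [contDiffOn_clm_apply]
  intro a
  rw [contDiffOn_clm_apply]
  intro b
  rw [← contMDiffOn_iff_contDiffOn]
  exact (contMDiffOn_mfderiv_symm p a).inner_bundle (contMDiffOn_mfderiv_symm p b)

lemma contDiffAt_metricInChart {p : M} {z : EuclideanSpace ℝ (Fin n)}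
    (hz : z ∈ (extChartAt (𝓡 n) p).target) : ContDiffAt ℝ ∞ (metricInChart (n := n) p) z :=
  (contDiffOn_metricInChart p).contDiffAt ((isOpen_extChartAt_target p).mem_nhds hz)

lemma christoffel_self {p : M} {z : EuclideanSpace ℝ (Fin n)}
    (hz : z ∈ (extChartAt (𝓡 n) p).target) (w a : EuclideanSpace ℝ (Fin n)) :
    christoffel n p z w w a = sprayCovector (metricInChart p) z w a := by
  have hd := (contDiffAt_metricInChart hz).differentiableAt (by simp)
  have key : ∀ u b c, fderiv ℝ (fun z' => chartMetric n p z' b c) z u =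
      fderiv ℝ (metricInChart (n := n) p) z u b c := by
    intro u b c
    have e := (hd.hasFDerivAt.clm_apply (hasFDerivAt_const b z)).clm_apply (hasFDerivAt_const c z)
    have e' : HasFDerivAt (fun z' => chartMetric n p z' b c) _ z := e
    rw [e'.fderiv]
    simp
  simp only [christoffel, sprayCovector_apply, key]
  ring

/-- The chart metric computes norms of tangent vectors. -/
lemma chartMetric_mfderiv_self {p y : M} (hy : y ∈ (extChartAt (𝓡 n) p).source)
    (v : TangentSpace (𝓡 n) y) :
    chartMetric n p (extChartAt (𝓡 n) p y)
      (mfderiv (𝓡 n) 𝓘(ℝ, EuclideanSpace ℝ (Fin n)) (extChartAt (𝓡 n) p) y v)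
      (mfderiv (𝓡 n) 𝓘(ℝ, EuclideanSpace ℝ (Fin n)) (extChartAt (𝓡 n) p) y v) = ‖v‖ ^ 2 := by
  have h := congrArg (fun V : TangentBundle (𝓡 n) M => inner ℝ V.2 V.2)
    (mfderiv_extChartAt_symm_comp hy v)
  exact h.trans (real_inner_self_eq_norm_sq v)

/-- Polarization of `chartMetric_mfderiv_self`. -/
lemma chartMetric_mfderiv {p y : M} (hy : y ∈ (extChartAt (𝓡 n) p).source)
    (v w : TangentSpace (𝓡 n) y) :
    chartMetric n p (extChartAt (𝓡 n) p y)
      (mfderiv (𝓡 n) 𝓘(ℝ, EuclideanSpace ℝ (Fin n)) (extChartAt (𝓡 n) p) y v)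
      (mfderiv (𝓡 n) 𝓘(ℝ, EuclideanSpace ℝ (Fin n)) (extChartAt (𝓡 n) p) y w) = inner ℝ v w := by
  set D := mfderiv (𝓡 n) 𝓘(ℝ, EuclideanSpace ℝ (Fin n)) (extChartAt (𝓡 n) p) y
  have h1 := chartMetric_mfderiv_self hy v
  have h2 := chartMetric_mfderiv_self hy w
  have h3 := chartMetric_mfderiv_self hy (v + w)
  have h4 : D (v + w) = D v + D w := map_add _ _ _
  have h5 := (chartMetric_add_self p (extChartAt (𝓡 n) p y) (D v) (D w)).symm.trans (h4 ▸ h3)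
  rw [norm_add_sq_real, ← h1, ← h2] at h5
  linarith

/-- The tangent vector with given coordinates. -/
def ofChart (p : M) (z a : EuclideanSpace ℝ (Fin n)) : TangentBundle (𝓡 n) M :=
  ⟨(extChartAt (𝓡 n) p).symm z, mfderiv (𝓡 n) (𝓡 n) (extChartAt (𝓡 n) p).symm z a⟩

/-- The fibre coordinates of a tangent vector. -/
def toChart (p : M) (V : TangentBundle (𝓡 n) M) : EuclideanSpace ℝ (Fin n) :=
  mfderiv (𝓡 n) 𝓘(ℝ, EuclideanSpace ℝ (Fin n)) (extChartAt (𝓡 n) p) V.1 V.2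

lemma ofChart_toChart {p : M} {V : TangentBundle (𝓡 n) M}
    (hV : V.1 ∈ (extChartAt (𝓡 n) p).source) :
    ofChart p (extChartAt (𝓡 n) p V.1) (toChart p V) = V :=
  mfderiv_extChartAt_symm_comp hV V.2

lemma toChart_ofChart {p : M} {z : EuclideanSpace ℝ (Fin n)}
    (hz : z ∈ (extChartAt (𝓡 n) p).target) (a : EuclideanSpace ℝ (Fin n)) :
    toChart p (ofChart p z a) = a := by
  have h := mfderiv_extChartAt_comp_mfderivWithin_extChartAt_symm (I := 𝓡 n) hz
  rw [ModelWithCorners.Boundaryless.range_eq_univ, mfderivWithin_univ] at h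
  exact DFunLike.congr_fun h a

lemma chartMetric_toChart {p : M} {V : TangentBundle (𝓡 n) M}
    (hV : V.1 ∈ (extChartAt (𝓡 n) p).source) :
    chartMetric n p (extChartAt (𝓡 n) p V.1) (toChart p V) (toChart p V) = ‖V.2‖ ^ 2 :=
  chartMetric_mfderiv_self hV V.2

lemma eq_zero_of_chartMetric_self {p : M} {z a : EuclideanSpace ℝ (Fin n)}
    (hz : z ∈ (extChartAt (𝓡 n) p).target) (h : chartMetric n p z a a = 0) : a = 0 := by
  have h1 : (ofChart p z a).2 = 0 := inner_self_eq_zero.1 h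
  rw [← toChart_ofChart hz a, toChart, h1]
  exact map_zero _

/-- Positive definiteness gives injectivity, and the dual space has the same finite dimension. -/
lemma isInvertible_metricInChart {p : M} {z : EuclideanSpace ℝ (Fin n)}
    (hz : z ∈ (extChartAt (𝓡 n) p).target) : (metricInChart (n := n) p z).IsInvertible := by
  have hinj : Function.Injective (metricInChart (n := n) p z).toLinearMap := by
    rw [← LinearMap.ker_eq_bot, LinearMap.ker_eq_bot']
    intro a ha
    exact eq_zero_of_chartMetric_self hz (DFunLike.congr_fun ha a)
  have hfin : Module.finrank ℝ (EuclideanSpace ℝ (Fin n))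
      = Module.finrank ℝ (EuclideanSpace ℝ (Fin n) →L[ℝ] ℝ) := by
    rw [← (LinearMap.toContinuousLinearMap (𝕜 := ℝ) (E := EuclideanSpace ℝ (Fin n))
      (F' := ℝ)).finrank_eq, Module.finrank_linearMap]
    simp
  refine ⟨(LinearEquiv.ofInjectiveOfFinrankEq _ hinj hfin).toContinuousLinearEquiv, ?_⟩
  ext a b
  rfl

/-- The change of coordinates between two charts. -/
def transition (p q : M) (z : EuclideanSpace ℝ (Fin n)) : EuclideanSpace ℝ (Fin n) :=
  extChartAt (𝓡 n) q ((extChartAt (𝓡 n) p).symm z)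

lemma contDiffAt_transition {p q : M} {z : EuclideanSpace ℝ (Fin n)}
    (hz : z ∈ (extChartAt (𝓡 n) p).target)
    (hq : (extChartAt (𝓡 n) p).symm z ∈ (extChartAt (𝓡 n) q).source) :
    ContDiffAt ℝ ∞ (transition (n := n) p q) z := by
  rw [← contMDiffAt_iff_contDiffAt]
  have h1 := (contMDiffOn_extChartAt_symm (I := 𝓡 n) (n := ∞) p).contMDiffAt
    ((isOpen_extChartAt_target p).mem_nhds hz)
  have h2 : ContMDiffAt (𝓡 n) 𝓘(ℝ, EuclideanSpace ℝ (Fin n)) ∞ (extChartAt (𝓡 n) q)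
    ((extChartAt (𝓡 n) p).symm z) := contMDiffAt_extChartAt' (by simpa using hq)
  exact h2.comp z h1

lemma fderiv_transition {p q : M} {z : EuclideanSpace ℝ (Fin n)}
    (hz : z ∈ (extChartAt (𝓡 n) p).target)
    (hq : (extChartAt (𝓡 n) p).symm z ∈ (extChartAt (𝓡 n) q).source)
    (a : EuclideanSpace ℝ (Fin n)) :
    fderiv ℝ (transition p q) z a = toChart q (ofChart p z a) := by
  have h1 := (contMDiffOn_extChartAt_symm (I := 𝓡 n) (n := ∞) p).contMDiffAt
    ((isOpen_extChartAt_target p).mem_nhds hz)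
  have h2 : ContMDiffAt (𝓡 n) 𝓘(ℝ, EuclideanSpace ℝ (Fin n)) ∞ (extChartAt (𝓡 n) q)
    ((extChartAt (𝓡 n) p).symm z) := contMDiffAt_extChartAt' (by simpa using hq)
  have h3 := mfderiv_comp z (h2.mdifferentiableAt (by simp)) (h1.mdifferentiableAt (by simp))
  rw [← mfderiv_eq_fderiv]
  exact DFunLike.congr_fun h3 a

lemma chartMetric_transition {p q : M} {z : EuclideanSpace ℝ (Fin n)}
    (hz : z ∈ (extChartAt (𝓡 n) p).target)
    (hq : (extChartAt (𝓡 n) p).symm z ∈ (extChartAt (𝓡 n) q).source)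
    (a b : EuclideanSpace ℝ (Fin n)) :
    chartMetric n p z a b = chartMetric n q (transition p q z)
      (fderiv ℝ (transition p q) z a) (fderiv ℝ (transition p q) z b) := by
  rw [fderiv_transition hz hq, fderiv_transition hz hq]
  exact (chartMetric_mfderiv hq _ _).symm

/-- The velocity vector of a curve. -/
def velocity (γ : ℝ → M) (t : ℝ) : TangentBundle (𝓡 n) M :=
  ⟨γ t, mfderiv 𝓘(ℝ, ℝ) (𝓡 n) γ t (1 : ℝ)⟩

lemma hasDerivAt_extChartAt_comp {γ : ℝ → M} {t : ℝ} {p : M}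
    (hγ : MDifferentiableAt 𝓘(ℝ, ℝ) (𝓡 n) γ t) (hp : γ t ∈ (extChartAt (𝓡 n) p).source) :
    HasDerivAt (fun s => extChartAt (𝓡 n) p (γ s)) (toChart p (velocity γ t)) t := by
  have h1 : MDifferentiableAt (𝓡 n) 𝓘(ℝ, EuclideanSpace ℝ (Fin n)) (extChartAt (𝓡 n) p) (γ t) :=
    mdifferentiableAt_extChartAt (by simpa using hp)
  have h2 := (h1.hasMFDerivAt.comp t hγ.hasMFDerivAt)
  have h3 : HasFDerivAt (fun s => extChartAt (𝓡 n) p (γ s)) (_ : ℝ →L[ℝ] EuclideanSpace ℝ (Fin n))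
    t := hasMFDerivAt_iff_hasFDerivAt.1 h2
  exact h3.hasDerivAt

lemma velocity_eq_ofChart {γ : ℝ → M} {t : ℝ} {p : M}
    (hγ : MDifferentiableAt 𝓘(ℝ, ℝ) (𝓡 n) γ t) (hp : γ t ∈ (extChartAt (𝓡 n) p).source) :
    velocity γ t = ofChart p (extChartAt (𝓡 n) p (γ t))
      (deriv (fun s => extChartAt (𝓡 n) p (γ s)) t) := by
  rw [(hasDerivAt_extChartAt_comp hγ hp).deriv]
  exact (ofChart_toChart hp).symm

lemma velocity_comp {γ : ℝ → M} {f : ℝ → ℝ} {t a : ℝ}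
    (hγ : MDifferentiableAt 𝓘(ℝ, ℝ) (𝓡 n) γ (f t)) (hf : HasDerivAt f a t) :
    velocity (fun s => γ (f s)) t
      = (⟨γ (f t), a • mfderiv 𝓘(ℝ, ℝ) (𝓡 n) γ (f t) (1 : ℝ)⟩ : TangentBundle (𝓡 n) M) := by
  have h := hγ.hasMFDerivAt.comp t hf.hasFDerivAt.hasMFDerivAt
  refine TotalSpace.ext rfl (heq_of_eq ?_)
  have h1 : mfderiv 𝓘(ℝ, ℝ) (𝓡 n) (γ ∘ f) t = _ := h.mfderiv
  refine (DFunLike.congr_fun h1 (1 : ℝ)).trans ?_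
  have h2 : (mfderiv 𝓘(ℝ, ℝ) (𝓡 n) γ (f t)) (a • (1 : ℝ))
      = a • mfderiv 𝓘(ℝ, ℝ) (𝓡 n) γ (f t) (1 : ℝ) := map_smul _ _ _
  exact (congrArg (mfderiv 𝓘(ℝ, ℝ) (𝓡 n) γ (f t))
    (show ContinuousLinearMap.toSpanSingleton ℝ a 1 = a • (1 : ℝ) by simp)).trans h2

/-- Chart representatives of tangent vectors are locally controlled by the Riemannian norm. -/
lemma exists_norm_toChart_le (q : M) : ∃ C > (0 : ℝ), ∀ᶠ y in 𝓝 q, ∀ v : TangentSpace (𝓡 n) y,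
    ‖toChart q (⟨y, v⟩ : TangentBundle (𝓡 n) M)‖ ≤ C * ‖v‖ := by
  -- The local bound on trivializations needs only a continuous metric; the chart derivative is the
  -- tangent bundle trivialization at q.
  have : IsContinuousRiemannianBundle (EuclideanSpace ℝ (Fin n))
      (fun x : M => TangentSpace (𝓡 n) x) := by
    obtain ⟨g, hg, hg'⟩ := IsContMDiffRiemannianBundle.exists_contMDiff (IB := 𝓡 n) (n := ∞)
      (F := EuclideanSpace ℝ (Fin n)) (E := fun x : M => TangentSpace (𝓡 n) x)
    exact ⟨g, hg.continuous, hg'⟩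
  obtain ⟨C, hC, h⟩ := eventually_norm_trivializationAt_lt (EuclideanSpace ℝ (Fin n))
    (fun x : M => TangentSpace (𝓡 n) x) q
  refine ⟨C, hC, ?_⟩
  filter_upwards [h, chart_source_mem_nhds (EuclideanSpace ℝ (Fin n)) q] with y hy hyq v
  have h1 := ContinuousLinearMap.le_of_opNorm_le _ hy.le v
  have h2 : (trivializationAt (EuclideanSpace ℝ (Fin n))
      (fun x : M => TangentSpace (𝓡 n) x) q).continuousLinearMapAt ℝ y v
      = toChart q (⟨y, v⟩ : TangentBundle (𝓡 n) M) :=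
    DFunLike.congr_fun (TangentBundle.continuousLinearMapAt_trivializationAt (I := 𝓡 n) hyq) v
  rwa [h2] at h1

end Chart

/-! ### Second order chain rule along a curve -/

section SecondDerivative

variable {E F : Type*} [NormedAddCommGroup E] [NormedSpace ℝ E] [NormedAddCommGroup F]
  [NormedSpace ℝ F]

lemma deriv_deriv_comp {ψ : E → F} {c : ℝ → E} {t : ℝ} (hψ : ContDiffAt ℝ 2 ψ (c t))
    (hc : ContDiffAt ℝ 2 c t) :
    deriv (deriv fun s => ψ (c s)) t = fderiv ℝ (fderiv ℝ ψ) (c t) (deriv c t) (deriv c t)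
      + fderiv ℝ ψ (c t) (deriv (deriv c) t) := by
  have h1 : (deriv fun s => ψ (c s)) =ᶠ[𝓝 t] fun s => fderiv ℝ ψ (c s) (deriv c s) := by
    have e1 := hc.eventually (by simp)
    have e2 := hc.continuousAt.eventually (hψ.eventually (by simp))
    filter_upwards [e1, e2] with s hs1 hs2
    exact ((hs2.differentiableAt two_ne_zero).hasFDerivAt.comp_hasDerivAt s
      (hs1.differentiableAt two_ne_zero).hasDerivAt).deriv
  have h2 : HasDerivAt c (deriv c t) t := (hc.differentiableAt two_ne_zero).hasDerivAt
  have h3 : HasDerivAt (deriv c) (deriv (deriv c) t) t :=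
    (((hc.derivWithin (m := 1) (by norm_num)).differentiableAt one_ne_zero)).hasDerivAt
  have h4 : HasFDerivAt (fderiv ℝ ψ) (fderiv ℝ (fderiv ℝ ψ) (c t)) (c t) :=
    ((hψ.fderiv_right (m := 1) (by norm_num)).differentiableAt one_ne_zero).hasFDerivAt
  rw [h1.deriv_eq]
  exact ((h4.comp_hasDerivAt t h2).clm_apply h3).deriv

end SecondDerivative

/-! ### Chart independence and local uniqueness of geodesics -/

section Geodesic

variable {n : ℕ} {M : Type*} [MetricSpace M] [ChartedSpace (EuclideanSpace ℝ (Fin n)) M]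
  [RiemannianBundle (fun x : M => TangentSpace (𝓡 n) x)] [IsManifold (𝓡 n) ∞ M]
  [IsContMDiffRiemannianBundle (𝓡 n) ∞ (EuclideanSpace ℝ (Fin n))
      (fun x : M => TangentSpace (𝓡 n) x)]

/-- The geodesic equation at time `t` in the chart around `p`. -/
def GeodesicEq (p : M) (γ : ℝ → M) (t : ℝ) : Prop :=
  ∀ a : EuclideanSpace ℝ (Fin n),
    metricInChart p (extChartAt (𝓡 n) p (γ t))
        (deriv (deriv (fun s => extChartAt (𝓡 n) p (γ s))) t) a
      + sprayCovector (metricInChart p) (extChartAt (𝓡 n) p (γ t))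
        (deriv (fun s => extChartAt (𝓡 n) p (γ s)) t) a = 0

variable (n) in
/-- `γ` is `C²` near `t` and satisfies the geodesic equation at `t`. -/
def IsGeodesicAt (γ : ℝ → M) (t : ℝ) : Prop :=
  ContMDiffAt 𝓘(ℝ, ℝ) (𝓡 n) 2 γ t ∧
    ∀ p : M, γ t ∈ (extChartAt (𝓡 n) p).source → GeodesicEq (n := n) p γ t

/-- Localizing in time makes it possible to treat geodesics that are so far defined only on an
interval, as the extension argument requires. -/
lemma isGeodesic_iff {γ : ℝ → M} : IsGeodesic n γ ↔ ∀ t, IsGeodesicAt n γ t := by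
  have key : ∀ (p : M) (t : ℝ), γ t ∈ (extChartAt (𝓡 n) p).source → ∀ w a,
      christoffel n p (extChartAt (𝓡 n) p (γ t)) w w a
        = sprayCovector (metricInChart p) (extChartAt (𝓡 n) p (γ t)) w a :=
    fun p t hp w a => christoffel_self ((extChartAt (𝓡 n) p).map_source hp) w a
  constructor
  · rintro ⟨h1, h2⟩ t
    refine ⟨h1 t, fun p hp a => ?_⟩
    rw [← key p t hp, metricInChart_apply]
    exact h2 p t hp a
  · intro h
    refine ⟨fun t => (h t).1, fun p t hp a => ?_⟩
    rw [key p t hp]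
    exact (h t).2 p hp a

lemma contDiffAt_extChartAt_comp {γ : ℝ → M} {t : ℝ} {p : M}
    (hγ : ContMDiffAt 𝓘(ℝ, ℝ) (𝓡 n) 2 γ t) (hp : γ t ∈ (extChartAt (𝓡 n) p).source) :
    ContDiffAt ℝ 2 (fun s => extChartAt (𝓡 n) p (γ s)) t := by
  rw [← contMDiffAt_iff_contDiffAt]
  have h2 : ContMDiffAt (𝓡 n) 𝓘(ℝ, EuclideanSpace ℝ (Fin n)) ∞ (extChartAt (𝓡 n) p) (γ t) :=
    contMDiffAt_extChartAt' (by simpa using hp)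
  exact (h2.of_le ENat.LEInfty.out).comp t hγ

lemma eventually_mem_source {γ : ℝ → M} {t : ℝ} {p : M} (hγ : ContinuousAt γ t)
    (hp : γ t ∈ (extChartAt (𝓡 n) p).source) :
    ∀ᶠ s in 𝓝 t, γ s ∈ (extChartAt (𝓡 n) p).source :=
  hγ.eventually ((isOpen_extChartAt_source p).mem_nhds hp)

/-- It suffices to check the geodesic equation in one chart. -/
lemma isGeodesicAt_of_geodesicEq {γ : ℝ → M} {t : ℝ} {q : M}
    (hγ : ContMDiffAt 𝓘(ℝ, ℝ) (𝓡 n) 2 γ t) (hq : γ t ∈ (extChartAt (𝓡 n) q).source)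
    (h : GeodesicEq (n := n) q γ t) : IsGeodesicAt n γ t := by
  refine ⟨hγ, fun p hp a => ?_⟩
  set c := fun s => extChartAt (𝓡 n) p (γ s) with hc
  have hct : c t ∈ (extChartAt (𝓡 n) p).target := (extChartAt (𝓡 n) p).map_source hp
  have hsymm : (extChartAt (𝓡 n) p).symm (c t) = γ t := (extChartAt (𝓡 n) p).left_inv hp
  have hq' : (extChartAt (𝓡 n) p).symm (c t) ∈ (extChartAt (𝓡 n) q).source := by rwa [hsymm]
  have hψ : ContDiffAt ℝ 2 (transition (n := n) p q) (c t) :=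
    (contDiffAt_transition hct hq').of_le ENat.LEInfty.out
  have hc2 : ContDiffAt ℝ 2 c t := contDiffAt_extChartAt_comp hγ hp
  have hψt : transition (n := n) p q (c t) = extChartAt (𝓡 n) q (γ t) := by
    rw [transition, hsymm]
  have hev : (fun s => extChartAt (𝓡 n) q (γ s)) =ᶠ[𝓝 t] fun s => transition p q (c s) := by
    filter_upwards [eventually_mem_source hγ.continuousAt hp] with s hs
    rw [transition, hc]
    simp only [(extChartAt (𝓡 n) p).left_inv hs]
  have hd1 : deriv (fun s => extChartAt (𝓡 n) q (γ s)) t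
      = fderiv ℝ (transition p q) (c t) (deriv c t) := by
    rw [hev.deriv_eq]
    exact ((hψ.differentiableAt two_ne_zero).hasFDerivAt.comp_hasDerivAt t
      (hc2.differentiableAt two_ne_zero).hasDerivAt).deriv
  have hd2 := deriv_deriv_comp hψ hc2
  rw [← hev.deriv.deriv_eq] at hd2
  have hqt : extChartAt (𝓡 n) q (γ t) ∈ (extChartAt (𝓡 n) q).target :=
    (extChartAt (𝓡 n) q).map_source hq
  have hpull : ∀ᶠ z in 𝓝 (c t), ∀ a b, metricInChart p z a b
      = metricInChart q (transition p q z) (fderiv ℝ (transition p q) z a)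
        (fderiv ℝ (transition p q) z b) := by
    have e1 : ∀ᶠ z in 𝓝 (c t), z ∈ (extChartAt (𝓡 n) p).target :=
      (isOpen_extChartAt_target p).mem_nhds hct
    have e2 : ∀ᶠ z in 𝓝 (c t), (extChartAt (𝓡 n) p).symm z ∈ (extChartAt (𝓡 n) q).source :=
      (continuousAt_extChartAt_symm'' hct).eventually
        ((isOpen_extChartAt_source q).mem_nhds hq')
    filter_upwards [e1, e2] with z h1 h2 a b
    exact chartMetric_transition h1 h2 a b
  have hcov := sprayCovector_of_pullback hψ
    ((contDiffAt_metricInChart hct).differentiableAt (by simp))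
    (by rw [hψt]; exact (contDiffAt_metricInChart hqt).differentiableAt (by simp))
    (fun a b => chartMetric_comm _ _ _ _) hpull (deriv c t) a
  -- Test the equation in chart q on the image of a. The Hessian term in the acceleration is exactly
  -- the one by which the Christoffel symbols of the two charts differ.
  have hh := h (fderiv ℝ (transition p q) (c t) a)
  rw [hd1, hd2, map_add, _root_.add_apply, ← hψt] at hh
  change metricInChart p (c t) (deriv (deriv c) t) a
    + sprayCovector (metricInChart p) (c t) (deriv c t) a = 0
  rw [hcov, hpull.self_of_nhds, ← hh]
  ring

/-- In a chart, geodesics are integral curves of the geodesic field. -/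
lemma IsGeodesicAt.hasDerivAt {γ : ℝ → M} {t : ℝ} {p : M} (h : IsGeodesicAt n γ t)
    (hp : γ t ∈ (extChartAt (𝓡 n) p).source) :
    HasDerivAt (fun s => (extChartAt (𝓡 n) p (γ s), deriv (fun s => extChartAt (𝓡 n) p (γ s)) s))
      (geodesicField (metricInChart p)
        (extChartAt (𝓡 n) p (γ t), deriv (fun s => extChartAt (𝓡 n) p (γ s)) t)) t := by
  have hc := contDiffAt_extChartAt_comp h.1 hp
  have h1 := (hc.differentiableAt two_ne_zero).hasDerivAt
  have h2 := ((hc.derivWithin (m := 1) (by norm_num)).differentiableAt one_ne_zero).hasDerivAt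
  have hi := isInvertible_metricInChart ((extChartAt (𝓡 n) p).map_source hp)
  have h3 : deriv (deriv (fun s => extChartAt (𝓡 n) p (γ s))) t
      = -spray (metricInChart p)
        (extChartAt (𝓡 n) p (γ t), deriv (fun s => extChartAt (𝓡 n) p (γ s)) t) := by
    apply hi.injective
    rw [map_neg, metric_spray hi]
    ext a
    have := h.2 p hp a
    rw [_root_.neg_apply]
    linarith
  rw [h3] at h2
  exact h1.prodMk h2

/-- Integral curves of the geodesic field in a chart are geodesics. -/
lemma isGeodesicAt_of_hasDerivAt {p : M} {J : Set ℝ} (hJ : IsOpen J)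
    {α : ℝ → EuclideanSpace ℝ (Fin n) × EuclideanSpace ℝ (Fin n)}
    (hα : ∀ s ∈ J, HasDerivAt α (geodesicField (metricInChart p) (α s)) s)
    (hmem : ∀ s ∈ J, (α s).1 ∈ (extChartAt (𝓡 n) p).target) {t : ℝ} (ht : t ∈ J) :
    IsGeodesicAt n (fun s => (extChartAt (𝓡 n) p).symm (α s).1) t ∧
      velocity (fun s => (extChartAt (𝓡 n) p).symm (α s).1) t = ofChart p (α t).1 (α t).2 := by
  set γ := fun s => (extChartAt (𝓡 n) p).symm (α s).1 with hγ
  have hα1 : ∀ s ∈ J, HasDerivAt (fun s => (α s).1) (α s).2 s := fun s hs => (hα s hs).fst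
  have hα2 : ∀ s ∈ J, HasDerivAt (fun s => (α s).2) (-spray (metricInChart p) (α s)) s :=
    fun s hs => (hα s hs).snd
  have hfield : ∀ s ∈ J, ContDiffAt ℝ 1 (geodesicField (metricInChart (n := n) p)) (α s) :=
    fun s hs => contDiffAt_geodesicField
      ((contDiffAt_metricInChart (hmem s hs)).of_le ENat.LEInfty.out)
      (isInvertible_metricInChart (hmem s hs))
  -- Bootstrapping: α is continuous, so the velocity component has continuous derivative, and then
  -- the position component is C².
  have hd2 : ContDiffOn ℝ 1 (fun s => (α s).2) J := by
    rw [← zero_add (1 : ℕ∞ω), contDiffOn_succ_iff_deriv_of_isOpen hJ]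
    refine ⟨fun s hs => (hα2 s hs).differentiableAt.differentiableWithinAt, by simp, ?_⟩
    rw [contDiffOn_zero]
    have : ContinuousOn (fun s => (geodesicField (metricInChart p) (α s)).2) J := fun s hs =>
      (continuousAt_snd.comp ((hfield s hs).continuousAt.comp
        (hα s hs).continuousAt)).continuousWithinAt
    exact this.congr fun s hs => (hα2 s hs).deriv
  have hd1 : ContDiffOn ℝ 2 (fun s => (α s).1) J := by
    refine (contDiffOn_succ_iff_deriv_of_isOpen (n := 1) hJ).2 ?_
    exact ⟨fun s hs => (hα1 s hs).differentiableAt.differentiableWithinAt, by simp,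
      hd2.congr fun s hs => (hα1 s hs).deriv⟩
  have hc : (fun s => extChartAt (𝓡 n) p (γ s)) =ᶠ[𝓝 t] fun s => (α s).1 := by
    filter_upwards [hJ.mem_nhds ht] with s hs
    exact (extChartAt (𝓡 n) p).right_inv (hmem s hs)
  have hc' : deriv (fun s => extChartAt (𝓡 n) p (γ s)) =ᶠ[𝓝 t] fun s => (α s).2 := by
    refine hc.deriv.trans ?_
    filter_upwards [hJ.mem_nhds ht] with s hs
    exact (hα1 s hs).deriv
  have hsm : ContMDiffAt 𝓘(ℝ, ℝ) (𝓡 n) 2 γ t := by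
    have h1 := ((contMDiffOn_extChartAt_symm (I := 𝓡 n) (n := ∞) p).contMDiffAt
      ((isOpen_extChartAt_target p).mem_nhds (hmem t ht))).of_le
        (show (2 : ℕ∞ω) ≤ ∞ from ENat.LEInfty.out)
    exact h1.comp t (contMDiffAt_iff_contDiffAt.2 (hd1.contDiffAt (hJ.mem_nhds ht)))
  have hsrc : γ t ∈ (extChartAt (𝓡 n) p).source := (extChartAt (𝓡 n) p).map_target (hmem t ht)
  have hct : extChartAt (𝓡 n) p (γ t) = (α t).1 := hc.self_of_nhds
  have hct' : deriv (fun s => extChartAt (𝓡 n) p (γ s)) t = (α t).2 := hc'.self_of_nhds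
  refine ⟨isGeodesicAt_of_geodesicEq hsm hsrc fun a => ?_, ?_⟩
  · rw [hc'.deriv_eq, hct', hct, (hα2 t ht).deriv, map_neg,
      metric_spray (isInvertible_metricInChart (hmem t ht)), _root_.neg_apply, neg_add_cancel]
  · rw [velocity_eq_ofChart (hsm.mdifferentiableAt two_ne_zero) hsrc, hct', hct]

lemma velocity_congr {γ σ : ℝ → M} {t : ℝ} (h : γ =ᶠ[𝓝 t] σ) :
    velocity (n := n) γ t = velocity σ t :=
  TotalSpace.ext h.self_of_nhds (heq_of_eq (DFunLike.congr_fun h.mfderiv_eq (1 : ℝ)))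

lemma IsGeodesicAt.congr {γ σ : ℝ → M} {t : ℝ} (hγ : IsGeodesicAt n γ t) (h : γ =ᶠ[𝓝 t] σ) :
    IsGeodesicAt n σ t := by
  refine ⟨hγ.1.congr_of_eventuallyEq h.symm, fun p hp a => ?_⟩
  have hc : (fun s => extChartAt (𝓡 n) p (γ s)) =ᶠ[𝓝 t] fun s => extChartAt (𝓡 n) p (σ s) :=
    h.fun_comp _
  have := hγ.2 p (by rwa [h.self_of_nhds]) a
  rwa [hc.deriv_eq, hc.deriv.deriv_eq, h.self_of_nhds] at this

lemma IsGeodesicAt.mdifferentiableAt {γ : ℝ → M} {t : ℝ} (h : IsGeodesicAt n γ t) :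
    MDifferentiableAt 𝓘(ℝ, ℝ) (𝓡 n) γ t := h.1.mdifferentiableAt two_ne_zero

/-- Both terms of the geodesic equation scale by a². The case a = -1 reverses time and b ≠ 0 shifts
it. -/
lemma IsGeodesicAt.comp_affine {γ : ℝ → M} {a b t : ℝ} (h : IsGeodesicAt n γ (a * t + b)) :
    IsGeodesicAt n (fun s => γ (a * s + b)) t := by
  have haff : ContDiff ℝ 2 (fun s : ℝ => a * s + b) := by fun_prop
  have hd : ∀ (f : ℝ → EuclideanSpace ℝ (Fin n)) (s : ℝ),
      deriv (fun r => f (a * r + b)) s = a • deriv f (a * s + b) := by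
    intro f s
    rw [deriv_comp_mul_left a (fun r => f (r + b)), deriv_comp_add_const]
  refine ⟨h.1.comp t haff.contMDiff.contMDiffAt, fun p hp e => ?_⟩
  have h1 : deriv (fun s => extChartAt (𝓡 n) p (γ (a * s + b)))
      = fun s => a • deriv (fun r => extChartAt (𝓡 n) p (γ r)) (a * s + b) :=
    funext fun s => hd (fun r => extChartAt (𝓡 n) p (γ r)) s
  have h2 : deriv (deriv (fun s => extChartAt (𝓡 n) p (γ (a * s + b)))) t
      = a • a • deriv (deriv (fun r => extChartAt (𝓡 n) p (γ r))) (a * t + b) := by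
    rw [h1, deriv_fun_const_smul_field, hd]
  have h3 := h.2 p hp e
  rw [h2, h1]
  simp only [sprayCovector_apply, map_smul, _root_.smul_apply, smul_eq_mul] at h3 ⊢
  linear_combination a ^ 2 * h3

lemma velocity_comp_affine {γ : ℝ → M} {a b t : ℝ} (h : IsGeodesicAt n γ (a * t + b)) :
    velocity (fun s => γ (a * s + b)) t = (⟨γ (a * t + b),
      a • mfderiv 𝓘(ℝ, ℝ) (𝓡 n) γ (a * t + b) (1 : ℝ)⟩ : TangentBundle (𝓡 n) M) :=
  velocity_comp (f := fun s => a * s + b) h.mdifferentiableAt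
    (by simpa using ((hasDerivAt_id t).const_mul a).add_const b)

/-- Local uniqueness of geodesics. -/
lemma eventuallyEq_of_velocity_eq {γ σ : ℝ → M} {t : ℝ} (hγ : ∀ᶠ s in 𝓝 t, IsGeodesicAt n γ s)
    (hσ : ∀ᶠ s in 𝓝 t, IsGeodesicAt n σ s) (h : velocity (n := n) γ t = velocity σ t) :
    γ =ᶠ[𝓝 t] σ := by
  have hγt := hγ.self_of_nhds
  have hσt := hσ.self_of_nhds
  have h0 : γ t = σ t := congrArg TotalSpace.proj h
  have hp : γ t ∈ (extChartAt (𝓡 n) (γ t)).source := mem_extChartAt_source _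
  have hp' : σ t ∈ (extChartAt (𝓡 n) (γ t)).source := h0 ▸ hp
  have e1 := eventually_mem_source hγt.1.continuousAt hp
  have e2 := eventually_mem_source hσt.1.continuousAt hp'
  have hz := (extChartAt (𝓡 n) (γ t)).map_source hp
  have := eventuallyEq_of_hasDerivAt
    (f := geodesicField (metricInChart (γ t)))
    (α := fun s => (extChartAt (𝓡 n) (γ t) (γ s),
      deriv (fun s => extChartAt (𝓡 n) (γ t) (γ s)) s))
    (β := fun s => (extChartAt (𝓡 n) (γ t) (σ s),
      deriv (fun s => extChartAt (𝓡 n) (γ t) (σ s)) s)) (t₀ := t)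
    (contDiffAt_geodesicField ((contDiffAt_metricInChart hz).of_le ENat.LEInfty.out)
      (isInvertible_metricInChart hz))
    (by filter_upwards [hγ, e1] with s hs hs' using hs.hasDerivAt hs')
    (by filter_upwards [hσ, e2] with s hs hs' using hs.hasDerivAt hs')
    (by rw [(hasDerivAt_extChartAt_comp hγt.mdifferentiableAt hp).deriv,
          (hasDerivAt_extChartAt_comp hσt.mdifferentiableAt hp').deriv, h, h0])
  filter_upwards [this, e1, e2] with s hs hs1 hs2
  exact (extChartAt (𝓡 n) (γ t)).injOn hs1 hs2 (congrArg Prod.fst hs)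

end Geodesic

/-! ### Constant speed, gluing and geodesic completeness -/

section Completeness

variable {n : ℕ} {M : Type*} [MetricSpace M] [ChartedSpace (EuclideanSpace ℝ (Fin n)) M]
  [RiemannianBundle (fun x : M => TangentSpace (𝓡 n) x)] [IsManifold (𝓡 n) ∞ M]
  [IsContMDiffRiemannianBundle (𝓡 n) ∞ (EuclideanSpace ℝ (Fin n))
      (fun x : M => TangentSpace (𝓡 n) x)]

/-- Geodesics on a connected open set of times are determined by their velocity at one time. -/
lemma eqOn_of_velocity_eq {γ σ : ℝ → M} {J : Set ℝ} (hJ : IsPreconnected J) (ho : IsOpen J)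
    (hγ : ∀ t ∈ J, IsGeodesicAt n γ t) (hσ : ∀ t ∈ J, IsGeodesicAt n σ t) {t₀ : ℝ} (ht₀ : t₀ ∈ J)
    (h : velocity (n := n) γ t₀ = velocity σ t₀) : EqOn γ σ J := by
  have hA : IsOpen {t | γ =ᶠ[𝓝 t] σ} := isOpen_iff_mem_nhds.2 fun t ht => ht.eventually_nhds
  have hev : ∀ t ∈ J, velocity (n := n) γ t = velocity σ t → γ =ᶠ[𝓝 t] σ := fun t ht hv =>
    eventuallyEq_of_velocity_eq (by filter_upwards [ho.mem_nhds ht] with s hs using hγ s hs)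
      (by filter_upwards [ho.mem_nhds ht] with s hs using hσ s hs) hv
  -- Connectedness: the times near which the curves agree form an open set. At a limit time in J,
  -- positions and chart velocities agree by continuity, so local uniqueness applies again.
  have hsub := hJ.subset_of_closure_inter_subset hA ⟨t₀, ht₀, hev t₀ ht₀ h⟩ ?_
  · exact fun t ht => (hsub ht).self_of_nhds
  rintro t ⟨htA, htJ⟩
  refine hev t htJ ?_
  have hfr : ∃ᶠ s in 𝓝 t, γ =ᶠ[𝓝 s] σ := mem_closure_iff_frequently.1 htA
  have h0 : γ t = σ t := tendsto_nhds_unique_of_frequently_eq (hγ t htJ).1.continuousAt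
    (hσ t htJ).1.continuousAt (hfr.mono fun s hs => hs.self_of_nhds)
  have hp : γ t ∈ (extChartAt (𝓡 n) (γ t)).source := mem_extChartAt_source _
  have hp' : σ t ∈ (extChartAt (𝓡 n) (γ t)).source := h0 ▸ hp
  have h1 : deriv (fun s => extChartAt (𝓡 n) (γ t) (γ s)) t
      = deriv (fun s => extChartAt (𝓡 n) (γ t) (σ s)) t :=
    tendsto_nhds_unique_of_frequently_eq ((hγ t htJ).hasDerivAt hp).continuousAt.snd
      ((hσ t htJ).hasDerivAt hp').continuousAt.snd
      (hfr.mono fun s hs => (hs.fun_comp (extChartAt (𝓡 n) (γ t))).deriv_eq)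
  rw [velocity_eq_ofChart (hγ t htJ).mdifferentiableAt hp,
    velocity_eq_ofChart (hσ t htJ).mdifferentiableAt hp', h1, h0]

/-- With c the curve in a chart, the derivative of g(c', c') is (∂_{c'} g)(c', c') + 2g(c'', c'),
and the geodesic equation tested on c' says that this is zero. -/
lemma hasDerivAt_sq_speed {γ : ℝ → M} {t : ℝ} (hγ : ∀ᶠ s in 𝓝 t, IsGeodesicAt n γ s) :
    HasDerivAt (fun s => ‖(velocity (n := n) γ s).2‖ ^ 2) 0 t := by
  have hp : γ t ∈ (extChartAt (𝓡 n) (γ t)).source := mem_extChartAt_source _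
  set p := γ t
  have hγt := hγ.self_of_nhds
  set c := fun s => extChartAt (𝓡 n) p (γ s) with hc
  have hev : (fun s => ‖(velocity (n := n) γ s).2‖ ^ 2)
      =ᶠ[𝓝 t] fun s => metricInChart p (c s) (deriv c s) (deriv c s) := by
    filter_upwards [hγ, eventually_mem_source hγt.1.continuousAt hp] with s hs hs'
    rw [hc, (hasDerivAt_extChartAt_comp hs.mdifferentiableAt hs').deriv]
    exact (chartMetric_toChart (V := velocity γ s) hs').symm
  have hz := (extChartAt (𝓡 n) p).map_source hp
  have hG : HasFDerivAt (metricInChart (n := n) p) (fderiv ℝ (metricInChart p) (c t)) (c t) :=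
    ((contDiffAt_metricInChart hz).differentiableAt (by simp)).hasFDerivAt
  have hc2 : ContDiffAt ℝ 2 c t := contDiffAt_extChartAt_comp hγt.1 hp
  have h2 : HasDerivAt c (deriv c t) t := (hc2.differentiableAt two_ne_zero).hasDerivAt
  have h3 : HasDerivAt (deriv c) (deriv (deriv c) t) t :=
    (((hc2.derivWithin (m := 1) (by norm_num)).differentiableAt one_ne_zero)).hasDerivAt
  have h4 := ((hG.comp_hasDerivAt t h2).clm_apply h3).clm_apply h3
  refine (h4.congr_of_eventuallyEq hev).congr_deriv ?_
  have h5 := hγt.2 p hp (deriv c t)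
  have h6 : metricInChart p (c t) (deriv c t) (deriv (deriv c) t)
      = metricInChart p (c t) (deriv (deriv c) t) (deriv c t) := chartMetric_comm _ _ _ _
  rw [sprayCovector_apply] at h5
  simp only [Function.comp_apply, _root_.add_apply]
  rw [h6]
  change metricInChart p (c t) (deriv (deriv c) t) (deriv c t)
    + (fderiv ℝ (metricInChart p) (c t) (deriv c t) (deriv c t) (deriv c t)
      - 1 / 2 * fderiv ℝ (metricInChart p) (c t) (deriv c t) (deriv c t) (deriv c t)) = 0 at h5
  linarith

/-- Geodesics have constant speed. -/
lemma speed_eq {γ : ℝ → M} {J : Set ℝ} (hJ : IsPreconnected J) (ho : IsOpen J)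
    (hγ : ∀ t ∈ J, IsGeodesicAt n γ t) {s t : ℝ} (hs : s ∈ J) (ht : t ∈ J) :
    ‖(velocity (n := n) γ s).2‖ = ‖(velocity (n := n) γ t).2‖ := by
  have hd : ∀ r ∈ J, HasDerivAt (fun s => ‖(velocity (n := n) γ s).2‖ ^ 2) 0 r := fun r hr =>
    hasDerivAt_sq_speed (by filter_upwards [ho.mem_nhds hr] with s hs using hγ s hs)
  have := ho.is_const_of_deriv_eq_zero hJ
    (fun r hr => (hd r hr).differentiableAt.differentiableWithinAt)
    (fun r hr => (hd r hr).deriv) hs ht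
  exact (sq_eq_sq₀ (norm_nonneg _) (norm_nonneg _)).1 this

lemma pathELength_eq_of_speed {γ : ℝ → M} {a b k : ℝ} (hk : 0 ≤ k)
    (hγ : ∀ t ∈ Icc a b, ‖(velocity (n := n) γ t).2‖ = k) :
    pathELength (𝓡 n) γ a b = ENNReal.ofReal (k * (b - a)) := by
  rw [pathELength_eq_lintegral_mfderiv_Icc,
    MeasureTheory.setLIntegral_congr_fun (g := fun _ => ENNReal.ofReal k) measurableSet_Icc]
  · rw [MeasureTheory.setLIntegral_const, Real.volume_Icc, ENNReal.ofReal_mul hk]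
  · intro t ht
    rw [← hγ t ht]
    exact (ofReal_norm (velocity (n := n) γ t).2).symm

lemma dist_le_of_speed [IsRiemannianManifold (𝓡 n) M] {γ : ℝ → M} {a b k : ℝ} (hab : a ≤ b)
    (hk : 0 ≤ k) (hγ : ∀ t ∈ Icc a b, IsGeodesicAt n γ t)
    (hs : ∀ t ∈ Icc a b, ‖(velocity (n := n) γ t).2‖ = k) : dist (γ a) (γ b) ≤ k * (b - a) := by
  have h1 : ContMDiffOn 𝓘(ℝ, ℝ) (𝓡 n) 1 γ (Icc a b) := fun t ht =>
    ((hγ t ht).1.of_le one_le_two).contMDiffWithinAt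
  have h2 := riemannianEDist_le_pathELength h1 rfl rfl hab
  rw [← IsRiemannianManifold.out, pathELength_eq_of_speed hk hs, edist_dist] at h2
  exact (ENNReal.ofReal_le_ofReal_iff (mul_nonneg hk (sub_nonneg.2 hab))).1 h2

/-- Local existence of geodesics, with an existence time that is uniform near a point and for
bounded initial velocities. -/
lemma exists_isGeodesicAt (q : M) (K : ℝ) : ∃ ε > (0 : ℝ), ∀ᶠ y in 𝓝 q,
    ∀ v : TangentSpace (𝓡 n) y, ‖v‖ ≤ K → ∃ γ : ℝ → M,
      (∀ t ∈ Ioo (-ε) ε, IsGeodesicAt n γ t) ∧ velocity γ 0 = ⟨y, v⟩ := by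
  have hq : q ∈ (extChartAt (𝓡 n) q).source := mem_extChartAt_source _
  have hz := (extChartAt (𝓡 n) q).map_source hq
  set z₀ := extChartAt (𝓡 n) q q with hz₀
  have hf : ContDiffAt ℝ 1 (geodesicField (metricInChart (n := n) q)) (z₀, 0) :=
    contDiffAt_geodesicField ((contDiffAt_metricInChart hz).of_le ENat.LEInfty.out)
      (isInvertible_metricInChart hz)
  have hU : Prod.fst ⁻¹' (extChartAt (𝓡 n) q).target
      ∈ 𝓝 ((z₀, 0) : EuclideanSpace ℝ (Fin n) × EuclideanSpace ℝ (Fin n)) :=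
    continuousAt_fst ((isOpen_extChartAt_target q).mem_nhds hz)
  obtain ⟨r, hr, ε, hε, hflow⟩ := exists_local_flow_mem hf hU
  obtain ⟨C, hC, hCev⟩ := exists_norm_toChart_le (n := n) q
  set K' := max K 1
  have hK' : 0 < K' := lt_max_of_lt_right one_pos
  -- The flow is controlled only for coordinate velocities of norm at most r. Scaling v by l
  -- achieves this, and reparametrizing by l⁻¹ recovers v at the cost of the existence time lε.
  -- Replacing K by `max K 1` keeps l well defined and positive.
  set l := r / (C * K') with hl
  have hl0 : 0 < l := by positivity
  have hlr : C * (l * K') = r := by rw [hl]; field_simp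
  refine ⟨l * ε, by positivity, ?_⟩
  have hev : ∀ᶠ y in 𝓝 q, extChartAt (𝓡 n) q y ∈ closedBall z₀ r :=
    (continuousAt_extChartAt q).eventually (closedBall_mem_nhds _ hr)
  filter_upwards [hCev, hev, (isOpen_extChartAt_source (I := 𝓡 n) q).mem_nhds hq]
    with y hyC hyr hys v hv
  set w := toChart q (⟨y, l • v⟩ : TangentBundle (𝓡 n) M) with hw
  have hwr : ‖w‖ ≤ r := by
    refine (hyC _).trans ?_
    rw [norm_smul, Real.norm_of_nonneg hl0.le, ← hlr]
    have : ‖v‖ ≤ K' := hv.trans (le_max_left _ _)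
    gcongr
  obtain ⟨α, hα0, hα⟩ := hflow (extChartAt (𝓡 n) q y, w) (by
    rw [← closedBall_prod_same]
    exact ⟨hyr, by simpa using hwr⟩)
  have hgeo := fun t (ht : t ∈ Ioo (-ε) ε) => isGeodesicAt_of_hasDerivAt isOpen_Ioo
    (fun s hs => (hα s hs).1) (fun s hs => (hα s hs).2) ht
  have hmaps : ∀ t ∈ Ioo (-(l * ε)) (l * ε), l⁻¹ * t + 0 ∈ Ioo (-ε) ε := by
    intro t ht
    rw [add_zero, inv_mul_eq_div]
    exact ⟨by rw [lt_div_iff₀ hl0]; linarith [ht.1], by rw [div_lt_iff₀ hl0]; linarith [ht.2]⟩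
  refine ⟨fun s => (extChartAt (𝓡 n) q).symm (α (l⁻¹ * s + 0)).1,
    fun t ht => IsGeodesicAt.comp_affine (hgeo _ (hmaps t ht)).1, ?_⟩
  have h0 : (0 : ℝ) ∈ Ioo (-(l * ε)) (l * ε) := by
    have : 0 < l * ε := by positivity
    exact ⟨by linarith, this⟩
  rw [velocity_comp_affine (γ := fun s => (extChartAt (𝓡 n) q).symm (α s).1)
    (hgeo _ (hmaps 0 h0)).1]
  have h1 := (hgeo _ (hmaps 0 h0)).2
  have h2 : (α (l⁻¹ * 0 + 0)) = (extChartAt (𝓡 n) q y, w) := by simpa using hα0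
  have h3 : ofChart q (extChartAt (𝓡 n) q y) w = (⟨y, l • v⟩ : TangentBundle (𝓡 n) M) :=
    ofChart_toChart (V := (⟨y, l • v⟩ : TangentBundle (𝓡 n) M)) hys
  rw [h2, h3] at h1
  have h4 := congrArg (fun V : TangentBundle (𝓡 n) M =>
    (⟨V.1, l⁻¹ • V.2⟩ : TangentBundle (𝓡 n) M)) h1
  refine h4.trans ?_
  simp only [smul_smul, inv_mul_cancel₀ hl0.ne', one_smul]

/-- Two geodesics on overlapping intervals with a common velocity can be glued. -/
lemma exists_isGeodesicAt_glue {γ σ : ℝ → M} {a b c d t₀ : ℝ}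
    (hγ : ∀ t ∈ Ioo a b, IsGeodesicAt n γ t) (hσ : ∀ t ∈ Ioo c d, IsGeodesicAt n σ t)
    (h₁ : t₀ ∈ Ioo a b) (h₂ : t₀ ∈ Ioo c d) (h : velocity (n := n) γ t₀ = velocity σ t₀) :
    ∃ η : ℝ → M, (∀ t ∈ Ioo a d, IsGeodesicAt n η t) ∧ EqOn η γ (Iio b) := by
  have heq : EqOn γ σ (Ioo (max a c) (min b d)) :=
    eqOn_of_velocity_eq isPreconnected_Ioo isOpen_Ioo
      (fun t ht => hγ t ⟨(le_max_left _ _).trans_lt ht.1, ht.2.trans_le (min_le_left _ _)⟩)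
      (fun t ht => hσ t ⟨(le_max_right _ _).trans_lt ht.1, ht.2.trans_le (min_le_right _ _)⟩)
      ⟨max_lt h₁.1 h₂.1, lt_min h₁.2 h₂.2⟩ h
  have hη : EqOn (fun t => if t < b then γ t else σ t) γ (Iio b) := fun t ht => if_pos ht
  refine ⟨fun t => if t < b then γ t else σ t, fun t ht => ?_, hη⟩
  rcases lt_or_ge t b with htb | htb
  · refine (hγ t ⟨ht.1, htb⟩).congr ?_
    filter_upwards [isOpen_Iio.mem_nhds htb] with s hs using (hη hs).symm
  · have hc : max a c < t := (max_lt h₁.1 h₂.1).trans (h₁.2.trans_le htb)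
    refine (hσ t ⟨(le_max_right _ _).trans_lt hc, ht.2⟩).congr ?_
    filter_upwards [isOpen_Ioo.mem_nhds ⟨hc, ht.2⟩] with s hs
    by_cases hsb : s < b
    · rw [if_pos hsb]
      exact (heq ⟨hs.1, lt_min hsb hs.2⟩).symm
    · rw [if_neg hsb]

/-- Geodesics with the same initial velocity, defined on intervals around `0`, can be glued. -/
lemma exists_isGeodesicAt_sUnion {𝒥 : Set (Set ℝ)} (hne : 𝒥.Nonempty) {V : TangentBundle (𝓡 n) M}
    (h : ∀ J ∈ 𝒥, IsOpen J ∧ J.OrdConnected ∧ (0 : ℝ) ∈ J ∧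
      ∃ γ : ℝ → M, (∀ t ∈ J, IsGeodesicAt n γ t) ∧ velocity γ 0 = V) :
    ∃ γ : ℝ → M, (∀ t ∈ ⋃₀ 𝒥, IsGeodesicAt n γ t) ∧ velocity γ 0 = V := by
  classical
  have : Nonempty M := ⟨V.1⟩
  choose! ho hc h0 γ hγ hV using h
  have key : ∀ J ∈ 𝒥, ∀ J' ∈ 𝒥, EqOn (γ J) (γ J') (J ∩ J') := by
    intro J hJ J' hJ'
    have := hc J hJ
    have := hc J' hJ'
    refine eqOn_of_velocity_eq (n := n) (OrdConnected.inter ‹_› ‹_›).isPreconnected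
      ((ho J hJ).inter (ho J' hJ')) (fun t ht => hγ J hJ t ht.1) (fun t ht => hγ J' hJ' t ht.2)
      ⟨h0 J hJ, h0 J' hJ'⟩ ((hV J hJ).trans (hV J' hJ').symm)
  -- Pick for each time some interval of the family containing it; by `key` the value of the glued
  -- curve does not depend on the choice.
  let I : ℝ → Set ℝ := fun t => if ht : t ∈ ⋃₀ 𝒥 then ht.choose else ∅
  have hI : ∀ t ∈ ⋃₀ 𝒥, I t ∈ 𝒥 ∧ t ∈ I t := by
    intro t ht
    simp only [I, dif_pos ht]
    exact ht.choose_spec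
  have hev : ∀ J ∈ 𝒥, ∀ t ∈ J, γ J =ᶠ[𝓝 t] fun s => γ (I s) s := by
    intro J hJ t ht
    filter_upwards [(ho J hJ).mem_nhds ht] with s hs
    have := hI s ⟨J, hJ, hs⟩
    exact key J hJ _ this.1 ⟨hs, this.2⟩
  refine ⟨fun s => γ (I s) s, ?_, ?_⟩
  · rintro t ⟨J, hJ, ht⟩
    exact (hγ J hJ t ht).congr (hev J hJ t ht)
  · obtain ⟨J, hJ⟩ := hne
    rw [← velocity_congr (hev J hJ 0 (h0 J hJ)), hV J hJ]

variable [CompleteSpace M] [IsRiemannianManifold (𝓡 n) M]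

/-- On a complete manifold, geodesics on bounded intervals can be extended. -/
lemma exists_isGeodesicAt_extend {γ : ℝ → M} {a b : ℝ} (hab : a < b)
    (hγ : ∀ t ∈ Ioo a b, IsGeodesicAt n γ t) :
    ∃ d > b, ∃ η : ℝ → M, (∀ t ∈ Ioo a d, IsGeodesicAt n η t) ∧ EqOn η γ (Iio b) := by
  obtain ⟨m, hm⟩ := nonempty_Ioo.2 hab
  set k := ‖(velocity (n := n) γ m).2‖ with hk
  have hk0 : 0 ≤ k := norm_nonneg _
  have hspeed : ∀ t ∈ Ioo a b, ‖(velocity (n := n) γ t).2‖ = k := fun t ht =>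
    speed_eq isPreconnected_Ioo isOpen_Ioo hγ ht hm
  have hd : ∀ s ∈ Ioo a b, ∀ t ∈ Ioo a b, s ≤ t → dist (γ s) (γ t) ≤ k * (t - s) :=
    fun s hs t ht hst => dist_le_of_speed hst hk0
      (fun r hr => hγ r ⟨hs.1.trans_le hr.1, hr.2.trans_lt ht.2⟩)
      (fun r hr => hspeed r ⟨hs.1.trans_le hr.1, hr.2.trans_lt ht.2⟩)
  have hlip : LipschitzOnWith k.toNNReal γ (Ioo a b) := by
    refine LipschitzOnWith.of_dist_le_mul fun s hs t ht => ?_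
    rw [Real.coe_toNNReal _ hk0, Real.dist_eq]
    rcases le_total s t with h | h
    · rw [abs_sub_comm, abs_of_nonneg (sub_nonneg.2 h)]
      exact hd s hs t ht h
    · rw [abs_of_nonneg (sub_nonneg.2 h), dist_comm]
      exact hd t ht s hs h
  -- Completeness enters here: a curve of bounded speed has a limit q as time tends to b. The
  -- existence time ε is uniform near q, so restarting at a time within ε of b carries the geodesic
  -- past b.
  obtain ⟨u, -, hu, hlim⟩ := exists_seq_strictMono_tendsto' hab
  have hcau := hlip.cauchySeq_comp hlim.cauchySeq (range_subset_iff.2 hu)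
  obtain ⟨q, hq⟩ := cauchySeq_tendsto_of_complete hcau
  obtain ⟨ε, hε, hex⟩ := exists_isGeodesicAt (n := n) q k
  have h1 := hq.eventually hex
  have h2 : ∀ᶠ i in atTop, b - ε < u i := hlim.eventually (lt_mem_nhds (by linarith))
  obtain ⟨i, hi, hi'⟩ := (h1.and h2).exists
  obtain ⟨σ, hσ, hσV⟩ := hi (velocity (n := n) γ (u i)).2 (hspeed _ (hu i)).le
  have hmem : ∀ t ∈ Ioo (u i - ε) (u i + ε), 1 * t + -u i ∈ Ioo (-ε) ε := fun t ht =>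
    ⟨by linarith [ht.1], by linarith [ht.2]⟩
  have hui : u i ∈ Ioo (u i - ε) (u i + ε) := ⟨by linarith, by linarith⟩
  have hV : velocity (n := n) γ (u i) = velocity (fun s => σ (1 * s + -u i)) (u i) := by
    rw [velocity_comp_affine (hσ _ (hmem _ hui))]
    have h3 : 1 * u i + -u i = 0 := by ring
    rw [h3]
    simp only [one_smul]
    exact hσV.symm
  obtain ⟨η, hη, hηγ⟩ := exists_isGeodesicAt_glue hγ
    (fun t ht => (hσ _ (hmem t ht)).comp_affine) (hu i) hui hV
  exact ⟨u i + ε, by linarith, η, hη, hηγ⟩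

/-- With the left end fixed at -ε, consider the possible right ends. If they were bounded, gluing
would reach the supremum and `exists_isGeodesicAt_extend` would exceed it. -/
lemma exists_isGeodesicAt_forward (V : TangentBundle (𝓡 n) M) (T : ℝ) : ∃ a < (0 : ℝ),
    ∃ γ : ℝ → M, (∀ t ∈ Ioo a T, IsGeodesicAt n γ t) ∧ velocity γ 0 = V := by
  obtain ⟨ε, hε, hex⟩ := exists_isGeodesicAt (n := n) V.1 ‖V.2‖
  refine ⟨-ε, by linarith, ?_⟩
  let A : Set ℝ := {b | ε ≤ b ∧ ∃ γ : ℝ → M,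
    (∀ t ∈ Ioo (-ε) b, IsGeodesicAt n γ t) ∧ velocity γ 0 = V}
  have hεA : ε ∈ A := ⟨le_rfl, hex.self_of_nhds V.2 le_rfl⟩
  have hunb : ¬ BddAbove A := by
    intro hb
    have hle : ε ≤ sSup A := le_csSup hb hεA
    obtain ⟨γ, hγ, hγV⟩ := exists_isGeodesicAt_sUnion (n := n) (𝒥 := (fun b => Ioo (-ε) b) '' A)
      (V := V) ⟨_, mem_image_of_mem _ hεA⟩ (by
        rintro _ ⟨b, hbA, rfl⟩
        exact ⟨isOpen_Ioo, ordConnected_Ioo, ⟨by linarith, hε.trans_le hbA.1⟩, hbA.2⟩)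
    have hγ' : ∀ t ∈ Ioo (-ε) (sSup A), IsGeodesicAt n γ t := by
      intro t ht
      obtain ⟨b, hbA, hbt⟩ := exists_lt_of_lt_csSup ⟨ε, hεA⟩ ht.2
      exact hγ t ⟨_, mem_image_of_mem _ hbA, ht.1, hbt⟩
    obtain ⟨d, hd, η, hη, hηγ⟩ := exists_isGeodesicAt_extend (by linarith) hγ'
    have hdA : d ∈ A := by
      refine ⟨hle.trans hd.le, η, hη, ?_⟩
      rw [← hγV]
      refine velocity_congr ?_
      filter_upwards [isOpen_Iio.mem_nhds (show (0 : ℝ) < sSup A from hε.trans_le hle)] with s hs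
        using hηγ hs
    exact (le_csSup hb hdA).not_gt hd
  obtain ⟨b, hbA, hb⟩ := not_bddAbove_iff.1 hunb T
  obtain ⟨γ, hγ, hγV⟩ := hbA.2
  exact ⟨γ, fun t ht => hγ t ⟨ht.1, ht.2.trans hb⟩, hγV⟩

/-- A metrically complete Riemannian manifold is geodesically complete. -/
theorem exists_isGeodesic (x : M) (v : TangentSpace (𝓡 n) x) :
    ∃ γ : ℝ → M, IsGeodesicFrom n x v γ := by
  obtain ⟨γ, hγ, hγV⟩ := exists_isGeodesicAt_sUnion (n := n)
    (𝒥 := (fun T : ℝ => Ioo (-T) T) '' Ioi 0) (V := ⟨x, v⟩) 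
    ⟨_, mem_image_of_mem _ (mem_Ioi.2 (one_pos (α := ℝ)))⟩ (by
      rintro _ ⟨T, hT, rfl⟩
      have hT' : (0 : ℝ) < T := hT
      refine ⟨isOpen_Ioo, ordConnected_Ioo, ⟨by linarith, hT'⟩, ?_⟩
      obtain ⟨a, ha, γ₁, hγ₁, hV₁⟩ := exists_isGeodesicAt_forward (n := n) ⟨x, v⟩ T
      -- Backward existence: run the geodesic with velocity -v and reverse time.
      obtain ⟨b, hb, γ₂, hγ₂, hV₂⟩ := exists_isGeodesicAt_forward (n := n) ⟨x, -v⟩ T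
      have hmem : ∀ t ∈ Ioo (-T) (-b), -1 * t + 0 ∈ Ioo b T := fun t ht =>
        ⟨by linarith [ht.2], by linarith [ht.1]⟩
      have h0 : (0 : ℝ) ∈ Ioo (-T) (-b) := ⟨by linarith, by linarith⟩
      have hV : velocity (n := n) (fun s => γ₂ (-1 * s + 0)) 0 = ⟨x, v⟩ := by
        rw [velocity_comp_affine (hγ₂ _ (hmem _ h0))]
        have h3 : (-1 : ℝ) * 0 + 0 = 0 := by ring
        rw [h3]
        have h4 := congrArg (fun V : TangentBundle (𝓡 n) M =>
          (⟨V.1, (-1 : ℝ) • V.2⟩ : TangentBundle (𝓡 n) M)) hV₂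
        refine h4.trans ?_
        simp
      obtain ⟨η, hη, hηγ⟩ := exists_isGeodesicAt_glue
        (fun t ht => (hγ₂ _ (hmem t ht)).comp_affine) hγ₁ h0 ⟨ha, hT'⟩ (hV.trans hV₁.symm)
      refine ⟨η, hη, ?_⟩
      rw [← hV]
      refine velocity_congr ?_
      filter_upwards [isOpen_Iio.mem_nhds h0.2] with s hs using hηγ hs)
  refine ⟨γ, isGeodesic_iff.2 fun t => hγ t ⟨_, mem_image_of_mem _ (mem_Ioi.2 ?_ : |t| + 1 ∈ Ioi 0), ?_⟩, hγV⟩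
  · positivity
  · exact ⟨by linarith [neg_abs_le t], by linarith [le_abs_self t]⟩

end Completeness

/-! ### Exponential map, minimizing geodesics and the cut locus -/

section Exponential

variable {n : ℕ} {M : Type*} [MetricSpace M] [ChartedSpace (EuclideanSpace ℝ (Fin n)) M]
  [RiemannianBundle (fun x : M => TangentSpace (𝓡 n) x)] [IsManifold (𝓡 n) ∞ M]
  [IsContMDiffRiemannianBundle (𝓡 n) ∞ (EuclideanSpace ℝ (Fin n))
      (fun x : M => TangentSpace (𝓡 n) x)]

lemma IsGeodesicFrom.velocity_zero {x : M} {v : TangentSpace (𝓡 n) x} {γ : ℝ → M}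
    (h : IsGeodesicFrom n x v γ) : velocity γ 0 = (⟨x, v⟩ : TangentBundle (𝓡 n) M) := h.2

lemma IsGeodesicFrom.apply_zero {x : M} {v : TangentSpace (𝓡 n) x} {γ : ℝ → M}
    (h : IsGeodesicFrom n x v γ) : γ 0 = x := congrArg TotalSpace.proj h.velocity_zero

lemma IsGeodesicFrom.speed {x : M} {v : TangentSpace (𝓡 n) x} {γ : ℝ → M}
    (h : IsGeodesicFrom n x v γ) (t : ℝ) : ‖(velocity (n := n) γ t).2‖ = ‖v‖ := by
  rw [speed_eq isPreconnected_univ isOpen_univ (fun s _ => isGeodesic_iff.1 h.1 s) (mem_univ t)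
    (mem_univ 0)]
  exact congrArg (fun V : TangentBundle (𝓡 n) M => ‖V.2‖) h.velocity_zero

lemma IsGeodesic.eq_of_velocity_eq {γ σ : ℝ → M} (hγ : IsGeodesic n γ) (hσ : IsGeodesic n σ)
    {t : ℝ} (h : velocity (n := n) γ t = velocity σ t) : γ = σ :=
  eqOn_univ _ _ |>.1 <| eqOn_of_velocity_eq isPreconnected_univ isOpen_univ
    (fun s _ => isGeodesic_iff.1 hγ s) (fun s _ => isGeodesic_iff.1 hσ s) (mem_univ t) h

/-- By uniqueness of geodesics the choice made in `expMap` is immaterial. -/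
lemma IsGeodesicFrom.expMap_eq {x : M} {v : TangentSpace (𝓡 n) x} {γ : ℝ → M}
    (h : IsGeodesicFrom n x v γ) : expMap n x v = γ 1 := by
  have hex : ∃ γ : ℝ → M, IsGeodesicFrom n x v γ := ⟨γ, h⟩
  rw [expMap, dif_pos hex, hex.choose_spec.1.eq_of_velocity_eq h.1
    (hex.choose_spec.velocity_zero.trans h.velocity_zero.symm)]

lemma IsGeodesicFrom.comp_mul {x : M} {v : TangentSpace (𝓡 n) x} {γ : ℝ → M}
    (h : IsGeodesicFrom n x v γ) (t : ℝ) :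
    IsGeodesicFrom n x (t • v) (fun s => γ (t * s + 0)) := by
  refine ⟨isGeodesic_iff.2 fun s => (isGeodesic_iff.1 h.1 _).comp_affine, ?_⟩
  refine (velocity_comp_affine (isGeodesic_iff.1 h.1 _)).trans ?_
  rw [show t * 0 + 0 = (0 : ℝ) by ring]
  exact congrArg (fun V : TangentBundle (𝓡 n) M =>
    (⟨V.1, t • V.2⟩ : TangentBundle (𝓡 n) M)) h.velocity_zero

lemma IsGeodesicFrom.expMap_smul {x : M} {v : TangentSpace (𝓡 n) x} {γ : ℝ → M}
    (h : IsGeodesicFrom n x v γ) (t : ℝ) : expMap n x (t • v) = γ t := by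
  rw [(h.comp_mul t).expMap_eq, mul_one, add_zero]

lemma IsGeodesicFrom.initial_eq {x : M} {u v : TangentSpace (𝓡 n) x} {γ : ℝ → M}
    (hu : IsGeodesicFrom n x u γ) (hv : IsGeodesicFrom n x v γ) : u = v := by
  have h := hu.velocity_zero.symm.trans hv.velocity_zero
  simpa using h

variable [IsRiemannianManifold (𝓡 n) M]

lemma IsGeodesicFrom.dist_le {x : M} {v : TangentSpace (𝓡 n) x} {γ : ℝ → M}
    (h : IsGeodesicFrom n x v γ) {s t : ℝ} (hst : s ≤ t) : dist (γ s) (γ t) ≤ ‖v‖ * (t - s) :=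
  dist_le_of_speed hst (norm_nonneg v) (fun r _ => isGeodesic_iff.1 h.1 r) (fun r _ => h.speed r)

lemma IsGeodesicFrom.dist_le' {x : M} {v : TangentSpace (𝓡 n) x} {γ : ℝ → M}
    (h : IsGeodesicFrom n x v γ) {t : ℝ} (ht : 0 ≤ t) : dist x (γ t) ≤ t * ‖v‖ := by
  have := h.dist_le ht
  rwa [h.apply_zero, sub_zero, mul_comm] at this

/-- If a geodesic is minimizing up to some time, then it is so up to all earlier times. -/
lemma IsGeodesicFrom.dist_eq_of_le {x : M} {v : TangentSpace (𝓡 n) x} {γ : ℝ → M}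
    (h : IsGeodesicFrom n x v γ) {s t : ℝ} (hs : 0 ≤ s) (hst : s ≤ t)
    (ht : dist x (γ t) = t * ‖v‖) : dist x (γ s) = s * ‖v‖ := by
  refine le_antisymm (h.dist_le' hs) ?_
  have h1 := dist_triangle x (γ s) (γ t)
  have h2 := h.dist_le hst
  rw [ht] at h1
  linarith

lemma IsGeodesicFrom.isMinimizingGeodesic {x : M} {v : TangentSpace (𝓡 n) x} {γ : ℝ → M}
    (h : IsGeodesicFrom n x v γ) (hd : dist x (γ 1) = ‖v‖) :
    IsMinimizingGeodesic n γ x (γ 1) := by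
  refine ⟨h.1, h.apply_zero, rfl, ?_⟩
  rw [pathELength_eq_of_speed (norm_nonneg v) (fun t _ => h.speed t), edist_dist, hd, sub_zero,
    mul_one]

/-- The exponential map is injective near the origin. -/
lemma exists_pos_forall_eq_of_isGeodesicFrom (x : M) : ∃ ε > (0 : ℝ),
    ∀ (u v : TangentSpace (𝓡 n) x) (γ σ : ℝ → M), IsGeodesicFrom n x u γ →
      IsGeodesicFrom n x v σ → ‖u‖ < ε → ‖v‖ < ε → γ 1 = σ 1 → u = v := by
  have hx : x ∈ (extChartAt (𝓡 n) x).source := mem_extChartAt_source _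
  have hz := (extChartAt (𝓡 n) x).map_source hx
  set z₀ := extChartAt (𝓡 n) x x with hz₀
  -- The constant 1/2 is the one that `eq_of_second_order_of_lipschitz` needs; it is available
  -- because the spray has zero derivative at zero velocity.
  obtain ⟨U, hU, hlip⟩ := (hasStrictFDerivAt_spray
    ((contDiffAt_metricInChart (n := n) hz).of_le ENat.LEInfty.out)
    (isInvertible_metricInChart hz)).exists_lipschitzOnWith_of_nnnorm_lt (1 / 2) (by simp)
  obtain ⟨ρ, hρ, hρU⟩ := Metric.nhds_basis_ball.mem_iff.1 hU
  obtain ⟨C, hC, hCev⟩ := exists_norm_toChart_le (n := n) x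
  have hev : ∀ᶠ y in 𝓝 x, extChartAt (𝓡 n) x y ∈ ball z₀ ρ :=
    (continuousAt_extChartAt x).eventually (ball_mem_nhds _ hρ)
  obtain ⟨δ, hδ, hδs⟩ := Metric.eventually_nhds_iff.1
    ((hCev.and hev).and ((isOpen_extChartAt_source (I := 𝓡 n) x).mem_nhds hx))
  have hlip' : ∀ p ∈ U, ∀ q ∈ U, ‖spray (metricInChart (n := n) x) p
      - spray (metricInChart (n := n) x) q‖ ≤ 1 / 2 * ‖p - q‖ := by
    intro p hp q hq
    have := hlip.dist_le_mul p hp q hq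
    simpa [dist_eq_norm] using this
  -- Up to time 1 the geodesic stays within ‖u‖ < δ of x, and its coordinate speed is at most C‖u‖ <
  -- ρ, so the phase curve remains in U.
  have key : ∀ (u : TangentSpace (𝓡 n) x) (γ : ℝ → M), IsGeodesicFrom n x u γ →
      ‖u‖ < min δ (ρ / C) → ∀ t ∈ Icc (0 : ℝ) 1, γ t ∈ (extChartAt (𝓡 n) x).source ∧
        (extChartAt (𝓡 n) x (γ t), deriv (fun s => extChartAt (𝓡 n) x (γ s)) t) ∈ U := by
    intro u γ hγ hu t ht
    have hdist : dist (γ t) x < δ := by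
      rw [dist_comm]
      refine (hγ.dist_le' ht.1).trans_lt (lt_of_le_of_lt ?_ (hu.trans_le (min_le_left _ _)))
      exact mul_le_of_le_one_left (norm_nonneg _) ht.2
    obtain ⟨⟨h1, h2⟩, h3⟩ := hδs hdist
    refine ⟨h3, hρU ?_⟩
    rw [← ball_prod_same]
    refine ⟨h2, ?_⟩
    rw [(hasDerivAt_extChartAt_comp (isGeodesic_iff.1 hγ.1 t).mdifferentiableAt h3).deriv,
      mem_ball_zero_iff]
    have h4 : ‖toChart x (velocity (n := n) γ t)‖ ≤ C * ‖u‖ :=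
      (h1 (velocity (n := n) γ t).2).trans_eq (congrArg (C * ·) (hγ.speed t))
    refine lt_of_le_of_lt h4 ?_
    rw [← lt_div_iff₀' hC]
    exact hu.trans_le (min_le_right _ _)
  refine ⟨min δ (ρ / C), lt_min hδ (div_pos hρ hC), fun u v γ σ hγ hσ hu hv h1 => ?_⟩
  have kγ := key u γ hγ hu
  have kσ := key v σ hσ hv
  have oγ := fun t ht => (isGeodesic_iff.1 hγ.1 t).hasDerivAt (kγ t ht).1
  have oσ := fun t ht => (isGeodesic_iff.1 hσ.1 t).hasDerivAt (kσ t ht).1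
  have hd : deriv (fun s => extChartAt (𝓡 n) x (γ s)) 0
      = deriv (fun s => extChartAt (𝓡 n) x (σ s)) 0 := eq_of_second_order_of_lipschitz hlip' (fun t ht => (oγ t ht).fst)
    (fun t ht => (oσ t ht).fst) (fun t ht => (oγ t ht).snd) (fun t ht => (oσ t ht).snd)
    (fun t ht => (kγ t ht).2) (fun t ht => (kσ t ht).2)
    (by rw [hγ.apply_zero, hσ.apply_zero]) (by rw [h1])
  have h0 : (0 : ℝ) ∈ Icc (0 : ℝ) 1 := left_mem_Icc.2 zero_le_one
  have hvel : velocity (n := n) γ 0 = velocity σ 0 := by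
    rw [velocity_eq_ofChart (isGeodesic_iff.1 hγ.1 0).mdifferentiableAt (kγ 0 h0).1,
      velocity_eq_ofChart (isGeodesic_iff.1 hσ.1 0).mdifferentiableAt (kσ 0 h0).1, hd,
      hγ.apply_zero, hσ.apply_zero]
  have : γ = σ := hγ.1.eq_of_velocity_eq hσ.1 hvel
  exact hγ.initial_eq (this ▸ hσ)

/-- In a strongly convex set, minimizing geodesics are determined by their endpoints. -/
lemma StronglyConvex.initial_eq {S : Set M} (hS : StronglyConvex n S) {x : M} (hx : x ∈ S)
    {u v : TangentSpace (𝓡 n) x} {γ σ : ℝ → M} (hγ : IsGeodesicFrom n x u γ)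
    (hσ : IsGeodesicFrom n x v σ) (hu : dist x (γ 1) = ‖u‖) (hv : dist x (σ 1) = ‖v‖)
    (h : γ 1 = σ 1) (hmem : γ 1 ∈ S) : u = v := by
  obtain ⟨η, -, huniq, -⟩ := hS x hx (γ 1) hmem
  have h1 := huniq γ (hγ.isMinimizingGeodesic hu)
  have h2 := huniq σ (h ▸ hσ.isMinimizingGeodesic hv)
  -- Strong convexity gives agreement on [0,1] only; an interior time provides a full neighbourhood,
  -- hence equal velocities there and equality for all times.
  have hev : γ =ᶠ[𝓝 (1 / 2 : ℝ)] σ := by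
    filter_upwards [Icc_mem_nhds (show (0 : ℝ) < 1 / 2 by norm_num)
      (show (1 / 2 : ℝ) < 1 by norm_num)] with s hs
    exact (h1 hs).trans (h2 hs).symm
  have : γ = σ := hγ.1.eq_of_velocity_eq hσ.1 (velocity_congr hev)
  exact hγ.initial_eq (this ▸ hσ)

variable [CompleteSpace M]

lemma dist_expMap_of_mem_injectivityDomain {x : M} {v : TangentSpace (𝓡 n) x}
    (hv : v ∈ injectivityDomain n x) : dist x (expMap n x v) = ‖v‖ := by
  obtain ⟨γ, hγ⟩ := exists_isGeodesic x v
  obtain ⟨s, hs, hd⟩ := hv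
  rw [hγ.expMap_smul] at hd
  rw [hγ.expMap_eq, hγ.dist_eq_of_le zero_le_one hs.le hd, one_mul]

lemma StronglyConvex.injOn_expMap {S : Set M} (hS : StronglyConvex n S) {x : M} (hx : x ∈ S)
    {u v : TangentSpace (𝓡 n) x} (hu : dist x (expMap n x u) = ‖u‖)
    (hv : dist x (expMap n x v) = ‖v‖) (h : expMap n x u = expMap n x v)
    (hmem : expMap n x u ∈ S) : u = v := by
  obtain ⟨γ, hγ⟩ := exists_isGeodesic x u
  obtain ⟨σ, hσ⟩ := exists_isGeodesic x v
  rw [hγ.expMap_eq] at hu h hmem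
  rw [hσ.expMap_eq] at hv h
  exact hS.initial_eq hx hγ hσ hu hv h hmem

/-- Injectivity of `exp_x` on the whole injectivity domain is not needed: over points of S it
follows from uniqueness of minimizing geodesics. -/
lemma StronglyConvex.expInv_expMap {S : Set M} (hS : StronglyConvex n S) {x : M} (hx : x ∈ S)
    {v : TangentSpace (𝓡 n) x} (hv : v ∈ injectivityDomain n x) (hmem : expMap n x v ∈ S) :
    expInv n x (expMap n x v) = v := by
  have hex : ∃ u ∈ injectivityDomain n x, expMap n x u = expMap n x v := ⟨v, hv, rfl⟩
  rw [expInv, dif_pos hex]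
  obtain ⟨h1, h2⟩ := hex.choose_spec
  exact hS.injOn_expMap hx (dist_expMap_of_mem_injectivityDomain h1)
    (dist_expMap_of_mem_injectivityDomain hv) h2 (h2.symm ▸ hmem)

/-- A radial geodesic which stays in a strongly convex set avoiding the cut locus does not reach
the tangential cut locus. -/
lemma StronglyConvex.mem_injectivityDomain_of_ray {S : Set M} (hS : StronglyConvex n S) {x : M}
    (hx : x ∈ S) (hdef : S ⊆ expMap n x '' injectivityDomain n x) {u : TangentSpace (𝓡 n) x}
    (hray : ∀ t ∈ Icc (0 : ℝ) 1, expMap n x (t • u) ∈ S) : u ∈ injectivityDomain n x := by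
  obtain ⟨γ, hγ⟩ := exists_isGeodesic x u
  have hcont : Continuous γ := hγ.1.1.continuous
  -- The times up to which the ray minimizes form a compact set; τ below is its greatest element.
  set A : Set ℝ := Icc 0 1 ∩ {t | dist x (γ t) = t * ‖u‖} with hA
  have hAc : IsCompact A := isCompact_Icc.inter_right
    (isClosed_eq (continuous_const.dist hcont) (continuous_id.mul continuous_const))
  have h0A : (0 : ℝ) ∈ A := ⟨left_mem_Icc.2 zero_le_one, by simp [hγ.apply_zero]⟩
  obtain ⟨τ, hτA, hτ⟩ := hAc.exists_isGreatest ⟨0, h0A⟩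
  -- For small t the point γ t lies in S, so it is the exponential of some v with ‖v‖ = d(x, γ t) ≤
  -- t‖u‖ < ε. Injectivity near the origin gives v = tu, so the ray minimizes up to t.
  have hτ0 : 0 < τ := by
    obtain ⟨ε, hε, hinj⟩ := exists_pos_forall_eq_of_isGeodesicFrom (n := n) x
    set t := min 1 (ε / (‖u‖ + 1)) with ht
    have hu1 : 0 < ‖u‖ + 1 := by positivity
    have ht0 : 0 < t := lt_min one_pos (div_pos hε hu1)
    have ht1 : t ∈ Icc (0 : ℝ) 1 := ⟨ht0.le, min_le_left _ _⟩
    have htε : t * ‖u‖ < ε := by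
      have : t * (‖u‖ + 1) ≤ ε := by
        rw [← le_div_iff₀ hu1]
        exact min_le_right _ _
      nlinarith
    obtain ⟨v, hv, hvt⟩ := hdef (hray t ht1)
    obtain ⟨σ, hσ⟩ := exists_isGeodesic x v
    have hnorm : ‖v‖ = dist x (γ t) := by
      rw [← dist_expMap_of_mem_injectivityDomain hv, hvt, hγ.expMap_smul]
    have htu : ‖t • u‖ = t * ‖u‖ := by rw [norm_smul, Real.norm_of_nonneg ht0.le]
    have huv : t • u = v := by
      refine hinj _ _ _ σ (hγ.comp_mul t) hσ (htu ▸ htε) ?_ ?_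
      · exact (hnorm.le.trans (hγ.dist_le' ht0.le)).trans_lt htε
      · rw [← hσ.expMap_eq, hvt, hγ.expMap_smul, mul_one, add_zero]
    have htA : t ∈ A := ⟨ht1, by
      change dist x (γ t) = t * ‖u‖
      rw [← hnorm, ← huv, htu]⟩
    exact ht0.trans_le (hτ htA)
  obtain ⟨v, hv, hvτ⟩ := hdef (hray τ hτA.1)
  have hτu : ‖τ • u‖ = τ * ‖u‖ := by rw [norm_smul, Real.norm_of_nonneg hτ0.le]
  have huv : τ • u = v := hS.injOn_expMap hx
    (by rw [hγ.expMap_smul, hτu]; exact hτA.2) (dist_expMap_of_mem_injectivityDomain hv)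
    hvτ.symm (hray τ hτA.1)
  rw [← huv] at hv
  obtain ⟨s, hs, hd⟩ := hv
  rw [smul_smul, hγ.expMap_smul, hτu, ← mul_assoc] at hd
  -- Since τu = v lies strictly before its cut point, the ray minimizes up to sτ. This time exceeds
  -- τ because τ > 0, so maximality of τ in [0,1] forces sτ > 1, and sτ witnesses that u is in the
  -- injectivity domain.
  have hsτ : τ < s * τ := by nlinarith
  have h1 : 1 < s * τ := by
    by_contra! hle
    exact (hτ ⟨⟨(hτ0.trans hsτ).le, hle⟩, hd⟩).not_gt hsτ
  have h1A : (1 : ℝ) ∈ A :=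
    ⟨right_mem_Icc.2 zero_le_one, hγ.dist_eq_of_le zero_le_one h1.le hd⟩
  exact ⟨s * τ, h1, by rw [hγ.expMap_smul, hd]⟩

end Exponential

end RiemGeo

end

/-! ### Convexity of the set of logarithms -/

theorem proposition3p2 {n : ℕ} {M : Type*} [MetricSpace M] [CompleteSpace M]
    [ChartedSpace (EuclideanSpace ℝ (Fin n)) M] [IsManifold (𝓡 n) ∞ M]
    [RiemannianBundle (fun x : M => TangentSpace (𝓡 n) x)]
    [IsContMDiffRiemannianBundle (𝓡 n) ∞ (EuclideanSpace ℝ (Fin n))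
      (fun x : M => TangentSpace (𝓡 n) x)]
    [IsRiemannianManifold (𝓡 n) M]
    (S : Set M) (hS : RiemGeo.StronglyConvex n S) (x : M) (hx : x ∈ S)
    (hdef : S ⊆ RiemGeo.expMap n x '' RiemGeo.injectivityDomain n x)
    (h2 : ∀ w₁ w₂ : ℝ, 0 ≤ w₁ → w₁ ≤ 1 → 0 ≤ w₂ → w₂ ≤ 1 → w₁ + w₂ = 1 →
      ∀ y₁ ∈ S, ∀ y₂ ∈ S, ∀ t ∈ Set.Icc (0 : ℝ) 1,
        RiemGeo.expMap n x
          (t • (w₁ • RiemGeo.expInv n x y₁ + w₂ • RiemGeo.expInv n x y₂)) ∈ S) :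
    ∀ (N : ℕ) (X : Fin N → M) (w : Fin N → ℝ),
      (∀ i, X i ∈ S) → (∀ i, 0 ≤ w i ∧ w i ≤ 1) → ∑ i, w i = 1 →
      ∀ t ∈ Set.Icc (0 : ℝ) 1,
        RiemGeo.expMap n x (t • ∑ i, w i • RiemGeo.expInv n x (X i)) ∈ S := by
  intro N X w hX hw hsum t ht
  set V : Set (TangentSpace (𝓡 n) x) :=
    {v | v ∈ RiemGeo.injectivityDomain n x ∧ RiemGeo.expMap n x v ∈ S} with hV
  have hinv : ∀ v ∈ V, RiemGeo.expInv n x (RiemGeo.expMap n x v) = v := fun v hv =>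
    hS.expInv_expMap hx hv.1 hv.2
  have hXV : ∀ i, RiemGeo.expInv n x (X i) ∈ V := by
    intro i
    obtain ⟨v, hv, hvX⟩ := hdef (hX i)
    have hvV : v ∈ V := ⟨hv, hvX ▸ hX i⟩
    rw [← hvX, hinv v hvV]
    exact hvV
  have hconv : Convex ℝ V := by
    intro v₁ hv₁ v₂ hv₂ a b ha hb hab
    -- The parameter t in the two-point hypothesis is essential: the whole ray in S, not just its
    -- endpoint, is what keeps the combination inside the injectivity domain.
    have hray : ∀ s ∈ Icc (0 : ℝ) 1, RiemGeo.expMap n x (s • (a • v₁ + b • v₂)) ∈ S := by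
      intro s hs
      have := h2 a b ha (by linarith) hb (by linarith) hab _ hv₁.2 _ hv₂.2 s hs
      rwa [hinv v₁ hv₁, hinv v₂ hv₂] at this
    refine ⟨hS.mem_injectivityDomain_of_ray hx hdef hray, ?_⟩
    simpa using hray 1 (right_mem_Icc.2 zero_le_one)
  have hmem : ∑ i, w i • RiemGeo.expInv n x (X i) ∈ V :=
    hconv.sum_mem (fun i _ => (hw i).1) hsum (fun i _ => hXV i)
  -- The scaling by t comes from the degenerate combination with weights 1 and 0 at the point whose
  -- logarithm is the weighted sum.
  have := h2 1 0 zero_le_one le_rfl le_rfl zero_le_one (add_zero 1) _ hmem.2 _ hmem.2 t ht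
  rwa [hinv _ hmem, one_smul, zero_smul, add_zero] at this
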